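/- Let $T$ be a finite tree with $n\ge 2$ vertices, with a fixed linear order on its vertex set $V$, and let $D$ be the corresponding double directed tree, that is, the directed graph on $V$ obtained from $T$ by replacing every edge $xy$ by the two directed edges $\overrightarrow{xy}$ and $\overrightarrow{yx}$. A *directed tree* is an acyclic directed graph with a root $r$ such that every vertex is reached from $r$ by a unique directed path; a *directed forest* is a family of vertex-disjoint directed trees. The *complex of directed trees* $\Delta(D)$ is the simplicial complex whose vertices are the directed edges of $D$ and whose faces are the sets of directed edges of $D$ that form a directed forest. A *leaf* is a vertex of degree $1$. A *basic tree* is a tree with exactly two vertices, or a tree with $2k$ vertices, $k$ of them leaves and $k$ of them non-leaves, such that every non-leaf is adjacent to exactly one leaf. Let $H$ be a subgraph of $T$. An *ordered decomposition* of $H$ into $m$ basic trees is a sequence $(B_1,\dots,B_m)$ of subgraphs defined recursively as follows. The empty sequence ($m=0$) is an ordered decomposition of the graph without vertices, and of no other graph. For $m\ge1$, let $v$ be the first leaf of $H$ in the given order (it has to exist), and let $H_1$ be the connected component of $H$ that contains $v$; then $(B_1,\dots,B_m)$ is an ordered decomposition of $H$ if $B_1$ is a subgraph of $H_1$ such that 1.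 $B_1$ is a basic tree and $v\in V(B_1)$; 2. $d_{B_1}(x)=d_{H_1}(x)$ for every $x\in V(B_1)$ that is not a leaf of $B_1$; 3. $|V(B_1)|>2$ whenever $|V(H_1)|>2$; and $(B_2,\dots,B_m)$ is an ordered decomposition of the graph obtained from $H$ by deleting the vertices $x\in V(B_1)$ with $d_{B_1}(x)=d_H(x)$. Let $\mu_m$ be the number of ordered decompositions of $T$ into $m$ basic trees. Then $n+m$ is odd and at least $3$ whenever $\mu_m\neq0$, and $$\Delta(D)\simeq\bigvee_m\Bigl(\bigvee^{\mu_m}\mathbb S^{\frac{n+m-3}{2}}\Bigr),$$ where $\simeq$ denotes homotopy equivalence and the wedge of the empty family is a point (so $\Delta(D)$ is contractible if all $\mu_m$ vanish). -/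

import Mathlib

namespace DirectedTrees

/-! ### Directed trees and directed forests -/

section Forests

variable {V : Type*}

/-- The set `F` of directed edges contains no directed cycle. -/
def IsAcyclicEdges (F : Set (V × V)) : Prop :=
  ∀ x : V, ¬ Relation.TransGen (fun a b => (a, b) ∈ F) x x

/-- `p` is the list of vertices of a directed path from `a` to `b` with edges in `F` (this is only
used for acyclic `F`, where vertices on a directed path cannot repeat). -/
def IsDirPath (F : Set (V × V)) (a b : V) (p : List V) : Prop :=
  p.IsChain (fun x y => (x, y) ∈ F) ∧ p.head? = some a ∧ p.getLast? = some b

/-- The directed graph with vertex set `S` and edge set `F` is a directed tree: it is acyclic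
and has a root from which every vertex is reached by a unique directed path. -/
def IsDirectedTree (S : Set V) (F : Set (V × V)) : Prop :=
  F ⊆ S ×ˢ S ∧ IsAcyclicEdges F ∧ ∃ r ∈ S, ∀ x ∈ S, ∃! p : List V, IsDirPath F r x p

/-- `F` is the edge set of a directed forest: a family of vertex-disjoint directed trees. -/
def IsDirectedForest (F : Set (V × V)) : Prop :=
  ∃ 𝒯 : Set (Set V × Set (V × V)),
    (∀ t ∈ 𝒯, IsDirectedTree t.1 t.2) ∧
    (∀ t ∈ 𝒯, ∀ t' ∈ 𝒯, t ≠ t' → Disjoint t.1 t'.1) ∧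
    F = ⋃ t ∈ 𝒯, t.2

theorem IsDirPath.snoc {F : Set (V × V)} {r a c : V} {p : List V} (h : IsDirPath F r a p)
    (hac : (a, c) ∈ F) : IsDirPath F r c (p ++ [c]) := by
  obtain ⟨h1, h2, h3⟩ := h
  refine ⟨?_, ?_, by simp⟩
  · rw [List.isChain_append]
    refine ⟨h1, by simp, ?_⟩
    intro x hx y hy
    rw [h3] at hx
    simp at hx hy
    subst hx hy
    exact hac
  · simp [List.head?_append, h2]

theorem IsDirPath.cases_snoc {F : Set (V × V)} {r c : V} {p : List V} (h : IsDirPath F r c p) :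
    (p = [c] ∧ r = c) ∨ ∃ q a, p = q ++ [c] ∧ IsDirPath F r a q ∧ (a, c) ∈ F := by
  obtain ⟨h1, h2, h3⟩ := h
  rcases List.eq_nil_or_concat p with rfl | ⟨q, x, rfl⟩
  · simp at h2
  · simp at h3
    subst h3
    rw [List.concat_eq_append] at h1 h2 ⊢
    rcases List.eq_nil_or_concat q with rfl | ⟨q', a, rfl⟩
    · left; simp at h2; simp [h2]
    · right
      rw [List.concat_eq_append] at h1 h2 ⊢
      refine ⟨_, a, rfl, ⟨(List.isChain_append.1 h1).1, ?_, by simp⟩,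
        (List.isChain_append.1 h1).2.2 a (by simp) x (by simp)⟩
      rw [List.head?_append] at h2
      cases hh : (q' ++ [a]).head? with
      | none => simp at hh
      | some y => rw [hh] at h2; simpa using h2

theorem isDirectedForest_iff [Finite V] (F : Set (V × V)) :
    IsDirectedForest F ↔
      IsAcyclicEdges F ∧ ∀ a b c, (a, c) ∈ F → (b, c) ∈ F → a = b := by
  constructor
  · rintro ⟨𝒯, hT, hd, rfl⟩
    have key : ∀ t ∈ 𝒯, ∀ t' ∈ 𝒯, ∀ x, x ∈ t.1 → x ∈ t'.1 → t = t' := by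
      intro t ht t' ht' x hx hx'
      by_contra hne
      exact Set.disjoint_left.1 (hd t ht t' ht' hne) hx hx'
    constructor
    · intro x hx
      have : ∀ y, Relation.TransGen (fun a b => (a, b) ∈ ⋃ t ∈ 𝒯, t.2) x y →
          ∃ t ∈ 𝒯, y ∈ t.1 ∧ Relation.TransGen (fun a b => (a, b) ∈ t.2) x y := by
        intro y hy
        induction hy with
        | single h =>
          obtain ⟨t, ht, h⟩ := Set.mem_iUnion₂.1 h
          exact ⟨t, ht, ((hT t ht).1 h).2, .single h⟩
        | tail _ h ih =>
          obtain ⟨t, ht, h⟩ := Set.mem_iUnion₂.1 h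
          obtain ⟨t', ht', hm, hp⟩ := ih
          obtain rfl := key t ht t' ht' _ ((hT t ht).1 h).1 hm
          exact ⟨t, ht, ((hT t ht).1 h).2, hp.tail h⟩
      obtain ⟨t, ht, -, hp⟩ := this x hx
      exact (hT t ht).2.1 x hp
    · intro a b c hac hbc
      obtain ⟨t, ht, h⟩ := Set.mem_iUnion₂.1 hac
      obtain ⟨t', ht', h'⟩ := Set.mem_iUnion₂.1 hbc
      obtain rfl := key t ht t' ht' c ((hT t ht).1 h).2 ((hT t' ht').1 h').2
      obtain ⟨hsub, -, r, -, hr⟩ := hT t ht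
      obtain ⟨p, hp, -⟩ := hr a (hsub h).1
      obtain ⟨q, hq, -⟩ := hr b (hsub h').1
      have e := (hr c (hsub h).2).unique (hp.snoc h) (hq.snoc h')
      have e' : p = q := by simpa using e
      subst e'
      have := hp.2.2.symm.trans hq.2.2
      simpa using this
  · rintro ⟨hac, hin⟩
    let R : V → V → Prop := fun a b => (a, b) ∈ F
    let S : V → Set V := fun r => {x | Relation.ReflTransGen R r x}
    let E : V → Set (V × V) := fun r => {e | e ∈ F ∧ Relation.ReflTransGen R r e.1}
    let Root : V → Prop := fun r => ∀ a, (a, r) ∉ F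
    have huniq : ∀ r r' x, Root r → Root r' → Relation.ReflTransGen R r x →
        Relation.ReflTransGen R r' x → r = r' := by
      intro r r' x hr hr' h
      induction h with
      | refl =>
        intro h'
        rcases Relation.ReflTransGen.cases_tail h' with h' | ⟨c, _, hc⟩
        · exact h'
        · exact absurd hc (hr c)
      | tail _ hbc ih =>
        intro h'
        rcases Relation.ReflTransGen.cases_tail h' with h' | ⟨c, hc', hc⟩
        · subst h'
          exact absurd hbc (hr' _)
        · have := hin _ _ _ hbc hc
          subst this
          exact ih hc'
    have hroot : ∀ x, ∃ r, Root r ∧ Relation.ReflTransGen R r x := by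
      have : Std.Irrefl (Relation.TransGen R) := ⟨hac⟩
      have wf : WellFounded (Relation.TransGen R) := Finite.wellFounded_of_trans_of_irrefl _
      intro x
      induction x using wf.induction with
      | _ x ih =>
        by_cases hx : Root x
        · exact ⟨x, hx, .refl⟩
        · have : ∃ a, (a, x) ∈ F := by simpa [Root] using hx
          obtain ⟨a, ha⟩ := this
          obtain ⟨r, hr, h⟩ := ih a (.single ha)
          exact ⟨r, hr, h.tail ha⟩
    refine ⟨{t | ∃ r, Root r ∧ t = (S r, E r)}, ?_, ?_, ?_⟩
    · rintro _ ⟨r, hr, rfl⟩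
      refine ⟨?_, ?_, r, Relation.ReflTransGen.refl, ?_⟩
      · rintro ⟨a, b⟩ ⟨hab, ha⟩
        exact ⟨ha, Relation.ReflTransGen.tail ha hab⟩
      · intro x hx
        exact hac x (Relation.TransGen.mono (fun a b h => h.1) x x hx)
      · intro x hx'
        have hx : Relation.ReflTransGen R r x := hx'
        clear hx'
        have hex : ∃ p, IsDirPath (E r) r x p := by
          induction hx with
          | refl => exact ⟨[r], by simp [IsDirPath]⟩
          | tail h1 h2 ih =>
            obtain ⟨p, hp⟩ := ih
            exact ⟨_, hp.snoc ⟨h2, h1⟩⟩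
        have hun : ∀ (n : ℕ) (p q : List V) (x : V), p.length = n → IsDirPath (E r) r x p →
            IsDirPath (E r) r x q → p = q := by
          intro n
          induction n with
          | zero =>
            intro p q x hn hp
            rw [List.length_eq_zero_iff] at hn
            subst hn
            simp [IsDirPath] at hp
          | succ n ih =>
            intro p q x hn hp hq
            rcases hp.cases_snoc with ⟨rfl, hrx⟩ | ⟨p', a, rfl, hp', ha⟩ <;>
            rcases hq.cases_snoc with ⟨rfl, hrx'⟩ | ⟨q', b, rfl, hq', hb⟩
            · rfl
            · subst hrx; exact absurd hb.1 (hr _)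
            · subst hrx'; exact absurd ha.1 (hr _)
            · obtain rfl := hin _ _ _ ha.1 hb.1
              rw [ih p' q' a (by simpa using hn) hp' hq']
        obtain ⟨p, hp⟩ := hex
        exact ⟨p, hp, fun q hq => hun _ q p x rfl hq hp⟩
    · rintro _ ⟨r, hr, rfl⟩ _ ⟨r', hr', rfl⟩ hne
      rw [Set.disjoint_left]
      intro x hx hx'
      obtain rfl := huniq r r' x hr hr' hx hx'
      exact hne rfl
    · ext ⟨a, b⟩
      simp only [Set.mem_iUnion, Set.mem_ofPred_eq]
      constructor
      · intro hab
        obtain ⟨r, hr, h⟩ := hroot a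
        exact ⟨(S r, E r), ⟨r, hr, rfl⟩, hab, h⟩
      · rintro ⟨_, ⟨r, hr, rfl⟩, h⟩
        exact h.1

theorem IsDirectedForest.mono [Finite V] {F F' : Set (V × V)} (h : IsDirectedForest F)
    (hF : F' ⊆ F) : IsDirectedForest F' := by
  rw [isDirectedForest_iff] at h ⊢
  exact ⟨fun x hx => h.1 x (Relation.TransGen.mono (fun _ _ hab => hF hab) x x hx),
    fun a b c h1 h2 => h.2 a b c (hF h1) (hF h2)⟩

/-- The complex of directed trees of the directed graph `D`: its simplices are the nonempty sets
of directed edges of `D` that form a directed forest. -/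
def directedTreeComplex [Finite V] (D : Digraph V) : PreAbstractSimplicialComplex (V × V) where
  faces := {F | F.Nonempty ∧ (∀ e ∈ F, D.Adj e.1 e.2) ∧ IsDirectedForest (F : Set (V × V))}
  isRelLowerSet_faces := by
    rintro F ⟨hne, hD, hF⟩
    exact ⟨hne, fun G hGF hG =>
      ⟨hG, fun e he => hD e (hGF he), hF.mono (Finset.coe_subset.2 hGF)⟩⟩

/-- The double directed graph of a simple graph: every edge is replaced by a pair of directed
edges going in opposite directions. -/
def doubleDigraph (G : SimpleGraph V) : Digraph V where
  Adj := G.Adj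

end Forests

/-! ### Topology: geometric realization, spheres, wedges -/

section Topology

/-- The geometric realization of a finite simplicial complex: the points, in barycentric
coordinates, of the standard simplex whose support is a face. It has the topology of a
subspace of `ι → ℝ`. -/
def Realization {ι : Type*} [Fintype ι] (K : PreAbstractSimplicialComplex ι) : Type _ :=
  {w : ι → ℝ // w ∈ stdSimplex ℝ ι ∧ ∃ s ∈ K.faces, (s : Set ι) = Function.support w}

instance {ι : Type*} [Fintype ι] (K : PreAbstractSimplicialComplex ι) :
    TopologicalSpace (Realization K) :=
  inferInstanceAs (TopologicalSpace {w : ι → ℝ //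
    w ∈ stdSimplex ℝ ι ∧ ∃ s ∈ K.faces, (s : Set ι) = Function.support w})

/-- The `d`-dimensional unit sphere in `ℝ^(d+1)`. -/
abbrev Sphere (d : ℕ) : Type :=
  Metric.sphere (0 : EuclideanSpace ℝ (Fin (d + 1))) 1

/-- The basepoint `(1, 0, …, 0)` of the sphere. -/
noncomputable def Sphere.basepoint (d : ℕ) : Sphere d :=
  ⟨EuclideanSpace.single 0 1, by simp⟩

/-- The gluing relation of a wedge: every basepoint is glued to one common extra point. -/
inductive WedgeRel {ι : Type*} {X : ι → Type*} (x : ∀ i, X i) :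
    Unit ⊕ (Σ i, X i) → Unit ⊕ (Σ i, X i) → Prop
  | glue (i : ι) : WedgeRel x (Sum.inl ()) (Sum.inr ⟨i, x i⟩)

/-- The wedge of a family of pointed spaces: the disjoint union of the spaces and of a one-point
space, with all basepoints identified with the extra point. The wedge of the empty
family is a point. -/
def Wedge {ι : Type*} {X : ι → Type*} (x : ∀ i, X i) : Type _ :=
  Quot (WedgeRel x)

instance {ι : Type*} {X : ι → Type*} [∀ i, TopologicalSpace (X i)] (x : ∀ i, X i) :
    TopologicalSpace (Wedge x) :=
  inferInstanceAs (TopologicalSpace (Quot (WedgeRel x)))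

end Topology

/-! ### Basic trees and ordered decompositions -/

section Decompositions

/-- A leaf of a graph: a vertex with exactly one neighbour. -/
def IsLeaf {W : Type*} (G : SimpleGraph W) (x : W) : Prop :=
  (G.neighborSet x).ncard = 1

/-- A basic tree: a tree with exactly two vertices, or a tree with `2k` vertices, of which `k` are
leaves and `k` are non-leaves, such that every non-leaf is adjacent to exactly one leaf. -/
def IsBasicTree {W : Type*} (G : SimpleGraph W) : Prop :=
  G.IsTree ∧
    (Nat.card W = 2 ∨
      ((∃ k : ℕ, Nat.card W = 2 * k ∧ {x | IsLeaf G x}.ncard = k ∧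
          {x | ¬ IsLeaf G x}.ncard = k) ∧
        ∀ x, ¬ IsLeaf G x → ∃! y, IsLeaf G y ∧ G.Adj x y))

variable {V : Type*} {T : SimpleGraph V}

/-- The degree of the vertex `x` in the subgraph `H`. -/
noncomputable def deg (H : T.Subgraph) (x : V) : ℕ :=
  (H.neighborSet x).ncard

/-- `v` is the first leaf of `H` in the linear order of the vertices. -/
def IsFirstLeaf [LinearOrder V] (H : T.Subgraph) (v : V) : Prop :=
  IsLeast {x | x ∈ H.verts ∧ deg H x = 1} v

/-- The connected component of the subgraph `H` that contains the vertex `v` of `H`. -/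
def component (H : T.Subgraph) (v : V) : T.Subgraph :=
  H.induce {x | H.spanningCoe.Reachable v x}

/-- `B` is a basic subtree of the tree `H` that contains `v`, whose non-leaves have full degree
in `H`, and that has more than two vertices if `H` does. -/
structure IsAdmissible (H : T.Subgraph) (v : V) (B : T.Subgraph) : Prop where
  le : B ≤ H
  isBasicTree : IsBasicTree B.coe
  mem : v ∈ B.verts
  deg_eq : ∀ x ∈ B.verts, deg B x ≠ 1 → deg B x = deg H x
  two_lt : 2 < H.verts.ncard → 2 < B.verts.ncard

/-- What remains of the forest `H` when all vertices of `B` are deleted whose degree in `B`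
equals their degree in `H`. -/
def remove (H B : T.Subgraph) : T.Subgraph :=
  H.deleteVerts {x | x ∈ B.verts ∧ deg B x = deg H x}

/-- The list `(B₁, …, Bₘ)` is an ordered decomposition of the forest `H` into basic trees: `B₁` is
admissible in the component of `H` that contains the first leaf of `H`, and the remaining
list is an ordered decomposition of what remains of `H`; the empty list decomposes only
the graph without vertices. -/
def IsOrderedDecomposition [LinearOrder V] : List T.Subgraph → T.Subgraph → Prop
  | [], H => H.verts = ∅
  | B :: L, H =>
      (∃ v, IsFirstLeaf H v ∧ IsAdmissible (component H v) v B) ∧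
        IsOrderedDecomposition L (remove H B)

/-- The number `μₘ` of ordered decompositions of `T` into `m` basic trees. -/
noncomputable def numDecompositions [LinearOrder V] (T : SimpleGraph V) (m : ℕ) : ℕ :=
  {L : List T.Subgraph | L.length = m ∧ IsOrderedDecomposition L ⊤}.ncard

end Decompositions

end DirectedTrees

/-! The idea is to remove from the complex one facet for each ordered decomposition, to show that
what is left collapses to a point, and to conclude that the whole complex is a wedge of spheres, one
for each removed facet.

Combinatorics. In a tree, a set of directed edges is a directed forest exactly when no vertex has
two incoming edges and no edge occurs in both directions (`forestFamily`). Let `v` be the first leaf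
of a forest `H`, let `w` be its neighbour, and root the tree at `v`. Among the edge sets without
`(v, w)`, the edge `(w, v)` can be inserted and deleted freely, so this part is a cone and
collapses. If `(v, w)` is present, no other edge enters `w`. For any other neighbour `x` of `w`,
either no child of `x` sends an edge to `x`, and then `(w, x)` is the apex of a cone; or exactly one
child `y` does, and the same question arises at the remaining children of `x`. The branches that
never end in a cone are indexed by the complete choices `S` (`IsComplete`). The edges of `H` that
meet a head of `S` form a basic tree: heads are its non-leaves and tails its leaves, with the usual
exception of a tree with two vertices. This makes complete choices correspond to the admissible
trees `B₁` (`IsComplete.isAdmissible`, `IsAdmissible.isComplete`). The forests that contain `S` are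
`S` together with an arbitrary forest of what remains after removal of `B₁`
(`IsComplete.mem_forestFamily_iff`), and `collapsible_forestFamily_sdiff` follows by induction on
the number of vertices. Counting edges gives `(n + m - 1) / 2` elements for a facet that comes from
`m` basic trees.

Topology. A nonempty collapsible complex is contractible (`Collapsible.contractibleSpace_geom`). If
a complex becomes contractible after removal of some open facets, then that contraction extends to a
homotopy of the whole complex, so collapsing the complement of these facets to a point is a homotopy
equivalence, and the quotient is a wedge of spheres (`Facets.nonempty_homotopyEquiv_wedge`). -/

open Topology

namespace DirectedTrees

/-! ### Homotopy equivalences from quotient maps -/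

section Quotient

/-- A quotient map that identifies only the points of `A` is a homotopy equivalence as soon as
the identity deforms to a map that contracts `A`, through maps that preserve `A`. -/
theorem nonempty_homotopyEquiv_of_isQuotientMap {X W : Type*} [TopologicalSpace X]
    [TopologicalSpace W] {q : X → W} (hq : IsQuotientMap q) {A : Set X}
    (hfib : ∀ x y, q x = q y → x = y ∨ x ∈ A ∧ y ∈ A)
    (hqA : ∀ a ∈ A, ∀ b ∈ A, q a = q b)
    {Φ : unitInterval × X → X} (hΦ : Continuous Φ) (h0 : ∀ x, Φ (0, x) = x)
    (hA : ∀ t, ∀ a ∈ A, Φ (t, a) ∈ A)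
    (h1 : ∀ a ∈ A, ∀ b ∈ A, Φ (1, a) = Φ (1, b)) :
    Nonempty (ContinuousMap.HomotopyEquiv X W) := by
  let e : C(X, X) := ⟨fun x => Φ (1, x), by fun_prop⟩
  have he : ∀ x y, q x = q y → e x = e y := by
    intro x y h
    rcases hfib x y h with rfl | ⟨hx, hy⟩
    · rfl
    · exact h1 x hx y hy
  let qc : C(X, W) := ⟨q, hq.continuous⟩
  let g : C(W, X) := IsQuotientMap.lift (f := qc) hq e he
  have hg : ∀ x, g (q x) = Φ (1, x) := fun x =>
    DFunLike.congr_fun (IsQuotientMap.lift_comp (f := qc) hq e he) x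
  -- The chosen preimage does not matter: two preimages differ only inside `A`, which `Φ` preserves
  -- and `q` collapses.
  let Ψ : unitInterval × W → W := fun p => q (Φ (p.1, Function.surjInv hq.surjective p.2))
  have hΨq : ∀ t x, Ψ (t, q x) = q (Φ (t, x)) := by
    intro t x
    rcases hfib _ _ (Function.surjInv_eq hq.surjective (q x)) with h | ⟨h, h'⟩
    · simp only [Ψ, h]
    · exact hqA _ (hA t _ h) _ (hA t _ h')
  have hΨ : Continuous Ψ := by
    -- The product of a quotient map with the locally compact unit interval is again a quotient map.
    refine hq.continuous_lift_prod_right ?_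
    simp only [hΨq]
    exact hq.continuous.comp hΦ
  refine ⟨⟨qc, g, ?_, ?_⟩⟩
  · refine ContinuousMap.Homotopic.symm ⟨⟨⟨Φ, hΦ⟩, h0, fun x => ?_⟩⟩
    exact (hg x).symm
  · refine ContinuousMap.Homotopic.symm ⟨⟨⟨Ψ, hΨ⟩, fun w => ?_, fun w => ?_⟩⟩
    · obtain ⟨x, rfl⟩ := hq.surjective w
      exact (hΨq 0 x).trans (congrArg q (h0 x))
    · obtain ⟨x, rfl⟩ := hq.surjective w
      exact (hΨq 1 x).trans (congrArg q (hg x).symm)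

/-- A homeomorphism between an open subset of a Hausdorff space and the complement of a point `p`
of a compact space extends to a continuous map with value `p` elsewhere. -/
theorem exists_continuous_collapse {X S : Type*} [TopologicalSpace X] [TopologicalSpace S]
    [T2Space X] [CompactSpace S] (p : S) {O : Set X} (hO : IsOpen O)
    (h : O ≃ₜ ({p}ᶜ : Set S)) :
    ∃ c : X → S, Continuous c ∧ (∀ x : O, c x = h x) ∧ ∀ x, x ∉ O → c x = p := by
  classical
  let c : X → S := fun x => if hx : x ∈ O then h ⟨x, hx⟩ else p
  have hc : ∀ x : O, c x = h x := fun x => by simp [c]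
  have hc' : ∀ x, x ∉ O → c x = p := fun x hx => by simp [c, hx]
  refine ⟨c, continuous_def.2 fun U hU => ?_, hc, hc'⟩
  -- If `p ∈ U`, the preimage is the complement of a compact set, which is closed because `X` is
  -- Hausdorff. If `p ∉ U`, the preimage lies in the open set `O`, where `c` is the given
  -- homeomorphism.
  by_cases hp : p ∈ U
  · have hK : IsCompact Uᶜ := hU.isClosed_compl.isCompact
    have hsub : Uᶜ ⊆ ({p}ᶜ : Set S) := by
      intro x hx hxp
      obtain rfl : x = p := hxp
      exact hx hp
    have hK' : IsCompact ((↑) ⁻¹' Uᶜ : Set ({p}ᶜ : Set S)) := by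
      rw [Subtype.isCompact_iff, Subtype.image_preimage_coe, Set.inter_eq_right.2 hsub]
      exact hK
    have hK'' : IsCompact ((fun y => ((h.symm y : O) : X)) '' ((↑) ⁻¹' Uᶜ : Set ({p}ᶜ : Set S))) :=
      hK'.image (continuous_subtype_val.comp h.symm.continuous)
    have : c ⁻¹' U =
        ((fun y => ((h.symm y : O) : X)) '' ((↑) ⁻¹' Uᶜ : Set ({p}ᶜ : Set S)))ᶜ := by
      ext x
      simp only [Set.mem_preimage, Set.mem_compl_iff, Set.mem_image, not_exists, not_and]
      constructor
      · rintro hx y hy rfl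
        rw [hc, h.apply_symm_apply] at hx
        exact hy hx
      · intro hx
        by_contra hxU
        have hxO : x ∈ O := by
          by_contra hxO
          rw [hc' x hxO] at hxU
          exact hxU hp
        refine hx (h ⟨x, hxO⟩) ?_ (by simp)
        rw [← hc ⟨x, hxO⟩]
        exact hxU
    rw [this]
    exact hK''.isClosed.isOpen_compl
  · have : c ⁻¹' U = (↑) '' {x : O | (h x : S) ∈ U} := by
      ext x
      simp only [Set.mem_preimage, Set.mem_image, Set.mem_ofPred_eq, Subtype.exists,
        exists_and_right, exists_eq_right]
      constructor
      · intro hx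
        have hxO : x ∈ O := by
          by_contra hxO
          rw [hc' x hxO] at hx
          exact hp hx
        exact ⟨hxO, by rwa [← hc ⟨x, hxO⟩]⟩
      · rintro ⟨hxO, hx⟩
        rwa [← hc ⟨x, hxO⟩] at hx
    rw [this]
    exact hO.isOpenMap_subtype_val _
      (hU.preimage (continuous_subtype_val.comp h.continuous))

end Quotient

/-! ### Points of a simplicial complex in barycentric coordinates -/

section Geometry

variable {ι : Type*}

/-- The least coordinate of `w` in `s` (and `0` if `s` is empty). -/
noncomputable def minCoord (s : Finset ι) (w : ι → ℝ) : ℝ :=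
  if h : s.Nonempty then s.inf' h w else 0

theorem minCoord_le {s : Finset ι} {i : ι} (hi : i ∈ s) (w : ι → ℝ) : minCoord s w ≤ w i := by
  rw [minCoord, dif_pos ⟨i, hi⟩]
  exact Finset.inf'_le _ hi

theorem exists_eq_minCoord {s : Finset ι} (hs : s.Nonempty) (w : ι → ℝ) :
    ∃ i ∈ s, w i = minCoord s w := by
  obtain ⟨i, hi, h⟩ := s.exists_mem_eq_inf' hs w
  exact ⟨i, hi, by rw [minCoord, dif_pos hs, h]⟩

theorem continuous_minCoord (s : Finset ι) : Continuous (minCoord s) := by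
  unfold minCoord
  split_ifs with h
  · exact Continuous.finset_inf'_apply h fun i _ => continuous_apply i
  · exact continuous_const

theorem minCoord_nonneg {w : ι → ℝ} (hw : ∀ i, 0 ≤ w i) (s : Finset ι) : 0 ≤ minCoord s w := by
  rcases s.eq_empty_or_nonempty with rfl | hs
  · simp [minCoord]
  · obtain ⟨i, -, h⟩ := exists_eq_minCoord hs w
    exact h ▸ hw i

variable [Fintype ι]

open Classical in
/-- The support of `w` as a finite set. -/
noncomputable def supp (w : ι → ℝ) : Finset ι :=
  Finset.univ.filter fun i => w i ≠ 0

@[simp]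
theorem mem_supp {w : ι → ℝ} {i : ι} : i ∈ supp w ↔ w i ≠ 0 := by
  simp [supp]

theorem coe_supp (w : ι → ℝ) : (supp w : Set ι) = Function.support w := by
  ext; simp

/-- The points of the standard simplex with support in `K`. -/
def geom (K : Set (Finset ι)) : Set (ι → ℝ) :=
  {w | w ∈ stdSimplex ℝ ι ∧ supp w ∈ K}

theorem mem_geom_iff {K : Set (Finset ι)} {w : ι → ℝ} :
    w ∈ geom K ↔ w ∈ stdSimplex ℝ ι ∧ ∃ s ∈ K, (s : Set ι) = Function.support w := by
  refine and_congr_right fun _ => ⟨fun h => ⟨_, h, coe_supp w⟩, ?_⟩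
  rintro ⟨s, hs, h⟩
  rw [← coe_supp, Finset.coe_inj] at h
  exact h ▸ hs

theorem subset_supp_of_minCoord_pos {s : Finset ι} {w : ι → ℝ} (h : 0 < minCoord s w) :
    s ⊆ supp w := fun i hi => by
  rw [mem_supp]
  exact (h.trans_le (minCoord_le hi w)).ne'

theorem minCoord_pos_of_subset_supp {s : Finset ι} (hs : s.Nonempty) {w : ι → ℝ}
    (hw : ∀ i, 0 ≤ w i) (h : s ⊆ supp w) : 0 < minCoord s w := by
  obtain ⟨i, hi, e⟩ := exists_eq_minCoord hs w
  rw [← e]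
  exact lt_of_le_of_ne (hw i) (Ne.symm (mem_supp.1 (h hi)))

/-- Replaces open cells by closed faces, which are compact; compactness of `geom K` then follows
from finiteness. -/
theorem geom_eq_iUnion {K : Set (Finset ι)} (hK : IsLowerSet K) :
    geom K = ⋃ s ∈ K, {w | w ∈ stdSimplex ℝ ι ∧ ∀ i, i ∉ s → w i = 0} := by
  ext w
  simp only [geom, Set.mem_ofPred_eq, Set.mem_iUnion, exists_prop]
  constructor
  · rintro ⟨h1, h2⟩
    exact ⟨_, h2, h1, by simp⟩
  · rintro ⟨s, hs, h1, h2⟩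
    refine ⟨h1, hK ?_ hs⟩
    intro i hi
    by_contra his
    exact mem_supp.1 hi (h2 i his)

theorem isCompact_geom {K : Set (Finset ι)} (hK : IsLowerSet K) : IsCompact (geom K) := by
  rw [geom_eq_iUnion hK]
  refine Set.Finite.isCompact_biUnion (Set.toFinite K) fun s _ => ?_
  refine (isCompact_stdSimplex ℝ ι).inter_right ?_
  have : {w : ι → ℝ | ∀ i, i ∉ s → w i = 0} = ⋂ i, ⋂ (_ : i ∉ s), {w | w i = 0} := by
    ext; simp
  change IsClosed {w : ι → ℝ | ∀ i, i ∉ s → w i = 0}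
  rw [this]
  exact isClosed_iInter fun i => isClosed_iInter fun _ =>
    isClosed_eq (continuous_apply i) continuous_const

end Geometry

/-! ### Collapsible families of finite sets -/

section Collapsible

variable {ι : Type*} [DecidableEq ι]

/-- A family of finite sets that can be reduced to the empty family by successively removing
pairs `σ ⊂ σ ∪ {x}` such that no further member of the family contains `σ`. -/
inductive Collapsible : Set (Finset ι) → Prop
  | empty : Collapsible ∅
  | step {K : Set (Finset ι)} (σ : Finset ι) (x : ι) (hx : x ∉ σ) (hσ : σ ∈ K)
      (hτ : insert x σ ∈ K) (hmax : ∀ ρ ∈ K, σ ⊆ ρ → ρ = σ ∨ ρ = insert x σ)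
      (h : Collapsible (K \ {σ, insert x σ})) : Collapsible K

/-- An upper part can be removed first. -/
theorem Collapsible.union {U M : Set (Finset ι)} (hU : Collapsible U) (hM : Collapsible M)
    (h : ∀ σ ∈ U, ∀ ρ ∈ M, ¬ σ ⊆ ρ) : Collapsible (U ∪ M) := by
  induction hU with
  | empty => rwa [Set.empty_union]
  | @step K σ x hx hσ hτ hmax _ ih =>
    refine .step σ x hx (.inl hσ) (.inl hτ) ?_ ?_
    · rintro ρ (hρ | hρ) hsub
      · exact hmax ρ hρ hsub
      · exact absurd hsub (h σ hσ ρ hρ)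
    · have : (K ∪ M) \ {σ, insert x σ} = K \ {σ, insert x σ} ∪ M := by
        rw [Set.union_sdiff_distrib]
        congr 1
        refine sdiff_eq_left.2 (Set.disjoint_left.2 ?_)
        rintro ρ hρ (rfl | rfl)
        · exact h _ hσ _ hρ subset_rfl
        · exact h _ hτ _ hρ subset_rfl
      rw [this]
      exact ih fun σ hσ => h σ hσ.1

/-- The members with `P` form an upper part of `K`, so their collapses are not obstructed by the
rest and can be done first. -/
theorem Collapsible.of_split {K : Set (Finset ι)} (P : Finset ι → Prop)
    (hU : Collapsible {σ ∈ K | P σ}) (hM : Collapsible {σ ∈ K | ¬ P σ})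
    (h : ∀ σ ∈ K, ∀ ρ ∈ K, P σ → σ ⊆ ρ → P ρ) : Collapsible K := by
  have : K = {σ ∈ K | P σ} ∪ {σ ∈ K | ¬ P σ} := by
    ext σ
    by_cases hσ : P σ <;> simp [hσ]
  rw [this]
  exact hU.union hM fun σ hσ ρ hρ hsub => hρ.2 (h σ hσ.1 ρ hρ.1 hσ.2 hsub)

/-- Branching over a finite set of elements that exclude each other. -/
theorem Collapsible.of_branches {K : Set (Finset ι)} (Y : Finset ι)
    (hY : ∀ σ ∈ K, ∀ a ∈ Y, ∀ b ∈ Y, a ∈ σ → b ∈ σ → a = b)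
    (h0 : Collapsible {σ ∈ K | ∀ a ∈ Y, a ∉ σ})
    (h : ∀ a ∈ Y, Collapsible {σ ∈ K | a ∈ σ}) : Collapsible K := by
  induction Y using Finset.induction_on generalizing K with
  | empty => simpa using h0
  | @insert a Y ha ih =>
    refine .of_split (fun σ => a ∈ σ) (h a (by simp)) (ih ?_ ?_ ?_) fun σ _ ρ _ h1 h2 => h2 h1
    · exact fun σ hσ b hb c hc => hY σ hσ.1 b (by simp [hb]) c (by simp [hc])
    · convert h0 using 1
      ext σ
      simp [and_assoc]
    · intro b hb
      convert h b (by simp [hb]) using 1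
      ext σ
      simp only [Set.mem_ofPred_eq, and_congr_left_iff, and_iff_left_iff_imp]
      intro hbσ hσ haσ
      exact ha (hY σ hσ a (by simp) b (by simp [hb]) haσ hbσ ▸ hb)

/-- A finite family that is closed under inserting and deleting `h` is collapsible. -/
theorem Collapsible.of_cone [Finite ι] (h : ι) (K : Set (Finset ι))
    (hi : ∀ σ ∈ K, insert h σ ∈ K) (he : ∀ σ ∈ K, σ.erase h ∈ K) : Collapsible K := by
  have hfin : K.Finite := Set.toFinite K
  induction hn : K.ncard using Nat.strong_induction_on generalizing K with
  | _ n ih =>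
    subst hn
    rcases K.eq_empty_or_nonempty with rfl | ⟨σ₀, hσ₀⟩
    · exact .empty
    -- A maximal member without `h` lies in no other member except `insert h σ`, and removing this
    -- pair preserves both closure properties.
    obtain ⟨σ, ⟨hσ, hhσ⟩, hmax⟩ := Set.Finite.exists_maximal
      (s := {σ ∈ K | h ∉ σ}) (Set.toFinite _) ⟨σ₀.erase h, he _ hσ₀, by simp⟩
    have key : ∀ ρ ∈ K, σ ⊆ ρ.erase h → ρ.erase h = σ := fun ρ hρ hs =>
      (hmax ⟨he ρ hρ, by simp⟩ hs).antisymm hs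
    have cases : ∀ ρ, ρ.erase h = σ → ρ = σ ∨ ρ = insert h σ := by
      rintro ρ rfl
      by_cases hh : h ∈ ρ
      · right; rw [Finset.insert_erase hh]
      · left; rw [Finset.erase_eq_of_notMem hh]
    refine .step σ h hhσ hσ (hi σ hσ) ?_ ?_
    · intro ρ hρ hs
      refine cases ρ (key ρ hρ ?_)
      rw [← Finset.erase_eq_of_notMem hhσ]
      exact Finset.erase_subset_erase h hs
    · refine ih _ ?_ _ ?_ ?_ (Set.toFinite _) rfl
      · exact Set.ncard_lt_ncard ⟨Set.sdiff_subset, fun hs => (hs hσ).2 (by simp)⟩ hfin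
      · rintro ρ ⟨hρ, hn⟩
        refine ⟨hi ρ hρ, ?_⟩
        rintro (e | e)
        · rw [← e] at hhσ; simp at hhσ
        · refine hn (cases ρ ?_)
          rw [← Finset.erase_insert_eq_erase, e, Finset.erase_insert hhσ]
      · rintro ρ ⟨hρ, hn⟩
        refine ⟨he ρ hρ, ?_⟩
        rintro (e | e)
        · exact hn (cases ρ e)
        · have := Finset.mem_insert_self h σ
          rw [← e] at this
          simp at this

/-- Adding a fixed set to all members of a collapsible family. -/
theorem Collapsible.union_left {K : Set (Finset ι)} (hK : Collapsible K) (S : Finset ι)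
    (hS : ∀ σ ∈ K, Disjoint S σ) : Collapsible {σ | S ⊆ σ ∧ σ \ S ∈ K} := by
  induction hK with
  | empty => simpa using Collapsible.empty
  | @step K σ x hx hσ hτ hmax _ ih =>
    have hxS : x ∉ S := fun hxS =>
      Finset.disjoint_left.1 (hS _ hτ) hxS (Finset.mem_insert_self x σ)
    have key : ∀ ρ ∈ K, (S ∪ ρ) \ S = ρ := fun ρ hρ =>
      Finset.union_sdiff_cancel_left (hS ρ hρ)
    refine .step (S ∪ σ) x (by simp [hx, hxS]) ⟨Finset.subset_union_left, ?_⟩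
      ⟨?_, ?_⟩ ?_ ?_
    · rwa [key σ hσ]
    · exact Finset.subset_union_left.trans (Finset.subset_insert _ _)
    · rwa [← Finset.union_insert, key _ hτ]
    · rintro ρ ⟨hSρ, hρ⟩ hsub
      rw [← Finset.union_insert, ← Finset.union_sdiff_of_subset hSρ]
      refine (hmax _ hρ ?_).imp (fun h => by rw [h]) (fun h => by rw [h])
      have := Finset.sdiff_subset_sdiff hsub (subset_refl S)
      rwa [key σ hσ] at this
    · convert ih fun ρ hρ => hS ρ hρ.1 using 1
      ext ρ
      simp only [Set.mem_sdiff, Set.mem_ofPred_eq, and_assoc]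
      refine and_congr_right fun hSρ => and_congr_right fun hρ => not_congr ?_
      simp only [Set.mem_insert_iff, Set.mem_singleton_iff]
      rw [← Finset.union_insert]
      refine or_congr ⟨?_, ?_⟩ ⟨?_, ?_⟩
      · rintro rfl; exact key σ hσ
      · intro e; rw [← e, Finset.union_sdiff_of_subset hSρ]
      · rintro rfl; exact key _ hτ
      · intro e; rw [← e, Finset.union_sdiff_of_subset hSρ]

end Collapsible

/-! ### Collapsible complexes are contractible -/

section Contractible

variable {ι : Type*} [DecidableEq ι]

/-- Move mass from the coordinates in `σ` to the coordinate `x`. -/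
noncomputable def push (σ : Finset ι) (x : ι) (t : ℝ) (w : ι → ℝ) (i : ι) : ℝ :=
  w i + t * minCoord σ w * ((if i = x then (σ.card : ℝ) else 0) - if i ∈ σ then 1 else 0)

theorem push_eq_self {σ : Finset ι} {x : ι} {t : ℝ} {w : ι → ℝ} (h : minCoord σ w = 0) :
    push σ x t w = w := by
  ext i
  simp [push, h]

theorem continuous_push (σ : Finset ι) (x : ι) :
    Continuous fun p : ℝ × (ι → ℝ) => push σ x p.1 p.2 := by
  refine continuous_pi fun i => ?_
  have := continuous_minCoord σ
  unfold push
  fun_prop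

variable [Fintype ι]

theorem push_mem_stdSimplex {σ : Finset ι} {x : ι} (hx : x ∉ σ) {t : ℝ} (ht : t ∈ unitInterval)
    {w : ι → ℝ} (hw : w ∈ stdSimplex ℝ ι) : push σ x t w ∈ stdSimplex ℝ ι := by
  have hm := minCoord_nonneg hw.1 σ
  refine ⟨fun i => ?_, ?_⟩
  · unfold push
    by_cases hi : i ∈ σ
    · have hix : i ≠ x := fun h => hx (h ▸ hi)
      have := minCoord_le hi w
      simp only [hix, hi, if_true, if_false]
      nlinarith [ht.1, ht.2]
    · have h1 : 0 ≤ t * minCoord σ w := mul_nonneg ht.1 hm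
      have h2 := hw.1 i
      simp only [hi, if_false, sub_zero]
      split_ifs <;> positivity
  · simp only [push, Finset.sum_add_distrib, ← Finset.mul_sum, Finset.sum_sub_distrib]
    rw [hw.2]
    simp

/-- A point moves only if its support contains `σ`; the support is then `σ` or `insert x σ`, and
mass moves only inside the latter. -/
theorem supp_push_mem {K : Set (Finset ι)} (hK : IsLowerSet K) {σ : Finset ι} {x : ι}
    (hτ : insert x σ ∈ K) (hmax : ∀ ρ ∈ K, σ ⊆ ρ → ρ = σ ∨ ρ = insert x σ) {t : ℝ}
    {w : ι → ℝ} (hw : w ∈ geom K) : supp (push σ x t w) ∈ K := by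
  rcases (minCoord_nonneg hw.1.1 σ).eq_or_lt with h | h
  · rw [push_eq_self h.symm]
    exact hw.2
  · refine hK (fun i hi => ?_) hτ
    have hs : supp w ⊆ insert x σ := by
      rcases hmax _ hw.2 (subset_supp_of_minCoord_pos h) with e | e <;> rw [e]
      exact Finset.subset_insert _ _
    by_contra hi'
    have h1 : w i = 0 := by
      by_contra h1
      exact hi' (hs (mem_supp.2 h1))
    rw [Finset.mem_insert, not_or] at hi'
    rw [mem_supp] at hi
    exact hi (by simp [push, h1, hi'.1, hi'.2])

/-- At time 1 the least coordinate in `σ` has become 0, so the point has left both removed cells. -/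
theorem push_one_mem {K : Set (Finset ι)} (hK : IsLowerSet K) {σ : Finset ι} {x : ι}
    (hσ : σ.Nonempty) (hx : x ∉ σ)
    (hτ : insert x σ ∈ K) (hmax : ∀ ρ ∈ K, σ ⊆ ρ → ρ = σ ∨ ρ = insert x σ)
    {w : ι → ℝ} (hw : w ∈ geom K) : push σ x 1 w ∈ geom (K \ {σ, insert x σ}) := by
  refine ⟨push_mem_stdSimplex hx ⟨by simp, by simp⟩ hw.1, supp_push_mem hK hτ hmax hw, ?_⟩
  obtain ⟨i, hi, h⟩ := exists_eq_minCoord hσ w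
  have hi0 : i ∉ supp (push σ x 1 w) := by
    have hix : i ≠ x := fun h => hx (h ▸ hi)
    simp [push, hix, hi, h]
  rintro (e | e)
  · exact hi0 (by rw [e]; exact hi)
  · rw [Set.mem_singleton_iff] at e
    exact hi0 (by rw [e]; exact Finset.mem_insert_of_mem hi)

/-- Each elementary collapse is a deformation by `push` onto the smaller complex. The empty set is a
member of the family, so the last pair removed is `∅, {x}`, and at that stage the space is a single
point. -/
theorem Collapsible.contractibleSpace_geom {K : Set (Finset ι)} (h : Collapsible K)
    (hK : IsLowerSet K) (hne : K.Nonempty) : ContractibleSpace (geom K) := by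
  induction h with
  | empty => simp at hne
  | @step K σ x hx hσ hτ hmax _ ih =>
    rcases σ.eq_empty_or_nonempty with rfl | hne'
    · have key : ∀ w ∈ geom K, w = Pi.single x 1 := by
        intro w hw
        have hs : supp w ⊆ {x} := by
          rcases hmax _ hw.2 (by simp) with e | e <;> simp [e]
        have h0 : ∀ i, i ≠ x → w i = 0 := by
          intro i hi
          by_contra h1
          exact hi (by simpa using hs (mem_supp.2 h1))
        have h1 := hw.1.2
        rw [Finset.sum_eq_single x (fun i _ hi => h0 i hi) (by simp)] at h1
        ext i
        by_cases hi : i = x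
        · subst hi; simpa using h1
        · simp [hi, h0 i hi]
      have hmem : Pi.single x 1 ∈ geom K := by
        refine ⟨single_mem_stdSimplex ℝ x, hK (fun i hi => ?_) hτ⟩
        by_contra hi'
        rw [mem_supp] at hi
        exact hi (by simp only [insert_empty_eq, Finset.mem_singleton] at hi'; simp [hi'])
      have : Unique (geom K) := ⟨⟨⟨_, hmem⟩⟩, fun w => Subtype.ext (key _ w.2)⟩
      infer_instance
    · have hK' : IsLowerSet (K \ {σ, insert x σ}) := by
        rintro ρ ρ' hρ ⟨h1, h2⟩
        refine ⟨hK hρ h1, ?_⟩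
        have : σ ⊆ ρ' → False := by
          intro h3
          exact h2 (hmax _ h1 (h3.trans hρ))
        rintro (e | e)
        · exact this e.superset
        · exact this ((Finset.subset_insert _ _).trans e.superset)
      have : ContractibleSpace (geom (K \ {σ, insert x σ})) := by
        refine ih hK' ⟨∅, hK (Finset.empty_subset σ) hσ, ?_⟩
        rintro (e | e)
        · exact hne'.ne_empty e.symm
        · exact Finset.insert_ne_empty x σ e.symm
      let i : C(geom (K \ {σ, insert x σ}), geom K) :=
        ⟨fun w => ⟨w, w.2.1, w.2.2.1⟩, by fun_prop⟩
      have hc := continuous_push σ x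
      let r : C(geom K, geom (K \ {σ, insert x σ})) :=
        ⟨fun w => ⟨push σ x 1 w, push_one_mem hK hne' hx hτ hmax w.2⟩,
          (hc.comp (by fun_prop : Continuous fun w : geom K => ((1 : ℝ), (w : ι → ℝ)))).subtype_mk
            _⟩
      have hir : (ContinuousMap.id (geom K)).Homotopic (i.comp r) := by
        refine ⟨⟨⟨fun p => ⟨push σ x p.1 p.2, push_mem_stdSimplex hx p.1.2 p.2.2.1,
          supp_push_mem hK hτ hmax p.2.2⟩, ?_⟩, fun w => ?_, fun w => ?_⟩⟩
        · exact (hc.comp (by fun_prop :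
            Continuous fun p : unitInterval × geom K => ((p.1 : ℝ), (p.2 : ι → ℝ)))).subtype_mk _
        · exact Subtype.ext (by ext; simp [push])
        · exact Subtype.ext (by simp [i, r])
      rw [contractible_iff_id_nullhomotopic]
      obtain ⟨y, hy⟩ := ((id_nullhomotopic (geom (K \ {σ, insert x σ}))).comp_left r).comp_right i
      exact ⟨y, hir.trans hy⟩

end Contractible

/-! ### Collapsing the complement of open cells -/

section WedgeQuotient

variable {J : Type*} {S : J → Type*} [∀ j, TopologicalSpace (S j)]

/-- The inclusion of a summand into the wedge. -/
def Wedge.of (b : ∀ j, S j) (j : J) (p : S j) : Wedge b :=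
  Quot.mk _ (Sum.inr ⟨j, p⟩)

/-- The common basepoint of the wedge. -/
def Wedge.base (b : ∀ j, S j) : Wedge b :=
  Quot.mk _ (Sum.inl ())

omit [∀ j, TopologicalSpace (S j)] in
theorem Wedge.of_base (b : ∀ j, S j) (j : J) : Wedge.of b j (b j) = Wedge.base b :=
  (Quot.sound (WedgeRel.glue j)).symm

theorem Wedge.continuous_of (b : ∀ j, S j) (j : J) : Continuous (Wedge.of b j) :=
  continuous_quot_mk.comp (continuous_inr.comp continuous_sigmaMk)

/-- The point of a wedge as a point of the summands, forgetting the basepoint. -/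
def Wedge.points (b : ∀ j, S j) : Wedge b → Set (Σ j, S j) :=
  Quot.lift (Sum.elim (fun _ => ∅) fun p => {z | z = p ∧ p.2 ≠ b p.1}) (by
    rintro _ _ ⟨j⟩
    simp)

omit [∀ j, TopologicalSpace (S j)] in
theorem Wedge.points_of (b : ∀ j, S j) (j : J) (p : S j) :
    Wedge.points b (Wedge.of b j p) = {z | z = ⟨j, p⟩ ∧ p ≠ b j} := rfl

omit [∀ j, TopologicalSpace (S j)] in
theorem Wedge.points_base (b : ∀ j, S j) : Wedge.points b (Wedge.base b) = ∅ := rfl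

theorem Wedge.isOpen_iff (b : ∀ j, S j) {U : Set (Wedge b)} :
    IsOpen U ↔ ∀ j, IsOpen (Wedge.of b j ⁻¹' U) := by
  constructor
  · exact fun h j => h.preimage (Wedge.continuous_of b j)
  · intro h
    have : IsOpen (Quot.mk (WedgeRel b) ⁻¹' U) := by
      rw [isOpen_sum_iff]
      exact ⟨isOpen_discrete _, isOpen_sigma_iff.2 h⟩
    exact isQuotientMap_quot_mk.isOpen_preimage.1 this

/-- Collapsing the complement `A` of finitely many disjoint open cells of a compact space gives the
wedge of the quotients of the closed cells. -/
theorem exists_isQuotientMap_wedge [Finite J] [∀ j, T2Space (S j)] {X : Type*}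
    [TopologicalSpace X] [CompactSpace X] (b : ∀ j, S j) (c : ∀ j, X → S j)
    (hc : ∀ j, Continuous (c j)) (O C : J → Set X) (hO : ∀ j, IsOpen (O j))
    (hC : ∀ j, IsClosed (C j)) (hOC : ∀ j, O j ⊆ C j)
    (hdisj : ∀ j k, j ≠ k → Disjoint (O j) (C k))
    (hbase : ∀ j, ∀ x ∉ O j, c j x = b j) (hinj : ∀ j, Set.InjOn (c j) (O j))
    (himg : ∀ j, c j '' O j = {b j}ᶜ) (hne : (⋃ j, O j)ᶜ.Nonempty) :
    ∃ q : X → Wedge b, IsQuotientMap q ∧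
      (∀ x y, q x = q y → x = y ∨ x ∈ (⋃ j, O j)ᶜ ∧ y ∈ (⋃ j, O j)ᶜ) ∧
      ∀ x ∈ (⋃ j, O j)ᶜ, ∀ y ∈ (⋃ j, O j)ᶜ, q x = q y := by
  classical
  let q : X → Wedge b := fun x =>
    if h : ∃ j, x ∈ O j then Wedge.of b h.choose (c h.choose x) else Wedge.base b
  have hqA : ∀ x ∈ (⋃ j, O j)ᶜ, q x = Wedge.base b := by
    intro x hx
    have : ¬ ∃ j, x ∈ O j := by simpa using hx
    exact dif_neg this
  have hqC : ∀ j, ∀ x ∈ C j, q x = Wedge.of b j (c j x) := by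
    intro j x hx
    by_cases h : ∃ j, x ∈ O j
    · have e : q x = Wedge.of b h.choose (c h.choose x) := dif_pos h
      have : h.choose = j := by
        by_contra hne
        exact Set.disjoint_left.1 (hdisj _ _ hne) h.choose_spec hx
      rw [e, this]
    · rw [hqA x (by simpa using h), hbase j x (fun hx => h ⟨j, hx⟩), Wedge.of_base]
  have hne_base : ∀ j, ∀ x ∈ O j, c j x ≠ b j := fun j x hx => by
    have : c j x ∈ ({b j}ᶜ : Set (S j)) := himg j ▸ ⟨x, hx, rfl⟩
    exact this
  -- The complement of the open cells and the closed cells form a finite closed cover, and `q` is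
  -- visibly continuous on each piece.
  have hcont : Continuous q := by
    let F : Option J → Set X := fun o => o.elim (⋃ j, O j)ᶜ C
    have hF : LocallyFinite F := locallyFinite_of_finite F
    refine hF.continuous (Set.eq_univ_of_forall fun x => ?_) ?_ ?_
    · by_cases h : ∃ j, x ∈ O j
      · obtain ⟨j, hj⟩ := h
        exact Set.mem_iUnion.2 ⟨some j, hOC j hj⟩
      · refine Set.mem_iUnion.2 ⟨none, ?_⟩
        simpa [F] using h
    · rintro (_ | j)
      · exact (isOpen_iUnion hO).isClosed_compl
      · exact hC j
    · rintro (_ | j)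
      · exact continuousOn_const.congr hqA
      · exact ((Wedge.continuous_of b j).comp (hc j)).continuousOn.congr (hqC j)
  refine ⟨q, ?_, ?_, fun x hx y hy => (hqA x hx).trans (hqA y hy).symm⟩
  · rw [isQuotientMap_iff, isCoinducing_iff, and_comm]
    refine ⟨?_, fun U => ⟨fun h => ?_, fun h => h.preimage hcont⟩⟩
    · obtain ⟨a, ha⟩ := hne
      intro w
      induction w using Quot.ind with
      | _ w =>
        rcases w with _ | ⟨j, p⟩
        · exact ⟨a, hqA a ha⟩
        · by_cases hp : p = b j
          · subst hp
            exact ⟨a, (hqA a ha).trans (Wedge.of_base b j).symm⟩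
          · obtain ⟨x, hx, rfl⟩ : p ∈ c j '' O j := by rw [himg]; exact hp
            exact ⟨x, hqC j x (hOC j hx)⟩
    · rw [Wedge.isOpen_iff]
      intro j
      have : CompactSpace (C j) := isCompact_iff_compactSpace.1 (hC j).isCompact
      -- A surjection from a compact space to a Hausdorff space is a quotient map. The extra point
      -- is needed because `c j` may miss the basepoint on `C j`, as happens for a facet with one
      -- vertex.
      let φ : Unit ⊕ C j → S j := Sum.elim (fun _ => b j) fun x => c j x
      have hφ : Continuous φ :=
        continuous_sumElim.2 ⟨continuous_const, (hc j).comp continuous_subtype_val⟩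
      have hs : Function.Surjective φ := by
        intro p
        by_cases hp : p = b j
        · exact ⟨.inl (), hp.symm⟩
        · obtain ⟨x, hx, rfl⟩ : p ∈ c j '' O j := by rw [himg]; exact hp
          exact ⟨.inr ⟨x, hOC j hx⟩, rfl⟩
      rw [← (IsQuotientMap.of_surjective_continuous hs hφ).isOpen_preimage, isOpen_sum_iff]
      refine ⟨isOpen_discrete _, ?_⟩
      convert h.preimage (continuous_subtype_val (p := fun x => x ∈ C j)) using 1
      ext x
      simp only [Set.mem_preimage]
      rw [hqC j x x.2]
      rfl
  · intro x y hxy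
    by_cases hx : ∃ j, x ∈ O j
    · obtain ⟨j, hj⟩ := hx
      -- `Wedge.points` is defined on the wedge itself, so it recovers the summand and the point
      -- from an equality there.
      have e := congrArg (Wedge.points b) hxy
      rw [hqC j x (hOC j hj), Wedge.points_of] at e
      have hmem : (⟨j, c j x⟩ : Σ j, S j) ∈ Wedge.points b (q y) := by
        rw [← e]
        exact ⟨rfl, hne_base j x hj⟩
      by_cases hy : ∃ k, y ∈ O k
      · obtain ⟨k, hk⟩ := hy
        rw [hqC k y (hOC k hk), Wedge.points_of] at hmem
        have := hmem.1
        obtain rfl : j = k := congrArg Sigma.fst this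
        left
        exact hinj j hj hk (eq_of_heq (Sigma.mk.inj this).2)
      · rw [hqA y (by simpa using hy), Wedge.points_base] at hmem
        exact hmem.elim
    · by_cases hy : ∃ k, y ∈ O k
      · obtain ⟨k, hk⟩ := hy
        have e := congrArg (Wedge.points b) hxy
        rw [hqC k y (hOC k hk), Wedge.points_of, hqA x (by simpa using hx),
          Wedge.points_base] at e
        have : (⟨k, c k y⟩ : Σ j, S j) ∈ (∅ : Set (Σ j, S j)) := by
          rw [e]
          exact ⟨rfl, hne_base k y hk⟩
        exact this.elim
      · right
        constructor
        · simpa using hx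
        · simpa using hy

end WedgeQuotient

/-! ### Open cells -/

section Cells

variable {ι : Type*} [Fintype ι]

/-- The point of the open simplex on `s` whose coordinates have given ratios. -/
noncomputable def cellPoint [DecidableEq ι] {d : ℕ} {s : Finset ι} (e : Fin (d + 1) ≃ s)
    (y : Fin d → ℝ) (i : ι) : ℝ :=
  if h : i ∈ s then
    (Fin.cons 1 (fun k => Real.exp (y k)) : Fin (d + 1) → ℝ) (e.symm ⟨i, h⟩) /
      ∑ k, (Fin.cons 1 (fun k => Real.exp (y k)) : Fin (d + 1) → ℝ) k
  else 0

/-- An open cell of a complex is homeomorphic to a euclidean space. -/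
noncomputable def cellHomeomorph [DecidableEq ι] {K : Set (Finset ι)} {d : ℕ} {s : Finset ι}
    (hs : s ∈ K) (e : Fin (d + 1) ≃ s) :
    {w : geom K | supp (w : ι → ℝ) = s} ≃ₜ (Fin d → ℝ) := by
  have hE : ∀ (y : Fin d → ℝ) k, 0 < (Fin.cons 1 (fun k => Real.exp (y k)) : Fin (d + 1) → ℝ) k := by
    intro y k
    refine Fin.cases ?_ (fun k => ?_) k
    · simp
    · simpa using Real.exp_pos _
  have hEsum : ∀ y : Fin d → ℝ,
      0 < ∑ k, (Fin.cons 1 (fun k => Real.exp (y k)) : Fin (d + 1) → ℝ) k :=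
    fun y => Finset.sum_pos (fun k _ => hE y k) Finset.univ_nonempty
  have hval : ∀ (y : Fin d → ℝ) k, cellPoint e y (e k) =
      (Fin.cons 1 (fun k => Real.exp (y k)) : Fin (d + 1) → ℝ) k /
        ∑ k, (Fin.cons 1 (fun k => Real.exp (y k)) : Fin (d + 1) → ℝ) k := by
    intro y k
    simp only [cellPoint, (e k).2, dif_pos, Subtype.coe_eta, e.symm_apply_apply]
  have hpos : ∀ (y : Fin d → ℝ) k, 0 < cellPoint e y (e k) := by
    intro y k
    rw [hval]
    exact div_pos (hE y k) (hEsum y)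
  have hsum : ∀ (w : ι → ℝ), (∀ i, i ∉ s → w i = 0) → ∑ i, w i = ∑ k, w (e k) := by
    intro w hw
    rw [← Finset.sum_subset (Finset.subset_univ s) fun i _ hi => hw i hi,
      ← Finset.sum_coe_sort s, ← e.sum_comp]
  have hsupp : ∀ y : Fin d → ℝ, supp (cellPoint e y) = s := by
    intro y
    ext i
    rw [mem_supp]
    constructor
    · intro h
      by_contra hi
      exact h (by simp [cellPoint, hi])
    · intro hi
      have := hpos y (e.symm ⟨i, hi⟩)
      rw [e.apply_symm_apply] at this
      exact this.ne'
  have hmem : ∀ y : Fin d → ℝ, cellPoint e y ∈ geom K := by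
    intro y
    refine ⟨⟨fun i => ?_, ?_⟩, (hsupp y).symm ▸ hs⟩
    · by_cases hi : i ∈ s
      · have := hpos y (e.symm ⟨i, hi⟩)
        rw [e.apply_symm_apply] at this
        exact this.le
      · simp [cellPoint, hi]
    · rw [hsum _ fun i hi => by simp [cellPoint, hi]]
      simp only [hval]
      rw [← Finset.sum_div, div_self (hEsum y).ne']
  have hw0 : ∀ w : {w : geom K | supp (w : ι → ℝ) = s}, ∀ k, 0 < (w : ι → ℝ) (e k) := by
    intro w k
    refine lt_of_le_of_ne (w.1.2.1.1 _) (Ne.symm ?_)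
    have : ((e k : s) : ι) ∈ supp (w : ι → ℝ) := by
      have := w.2
      rw [Set.mem_ofPred_eq] at this
      rw [this]
      exact (e k).2
    exact mem_supp.1 this
  refine
    -- The chart consists of the logarithms of the ratios to the zeroth barycentric coordinate;
    -- `cellPoint` exponentiates and normalizes.
    { toFun := fun w k => Real.log ((w : ι → ℝ) (e k.succ)) - Real.log ((w : ι → ℝ) (e 0))
      invFun := fun y => ⟨⟨cellPoint e y, hmem y⟩, hsupp y⟩
      left_inv := fun w => ?_
      right_inv := fun y => ?_
      continuous_toFun := ?_
      continuous_invFun := ?_ }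
  · refine Subtype.ext (Subtype.ext ?_)
    have hcons : (Fin.cons 1 (fun k : Fin d => Real.exp (Real.log ((w : ι → ℝ) (e k.succ)) -
        Real.log ((w : ι → ℝ) (e 0)))) : Fin (d + 1) → ℝ) =
        fun k => (w : ι → ℝ) (e k) / (w : ι → ℝ) (e 0) := by
      ext k
      refine Fin.cases ?_ (fun k => ?_) k
      · simp [(hw0 w 0).ne']
      · simp [Real.exp_sub, Real.exp_log (hw0 w _)]
    have hzero : ∀ i, i ∉ s → (w : ι → ℝ) i = 0 := by
      intro i hi
      by_contra h
      have h' := w.2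
      rw [Set.mem_ofPred_eq] at h'
      exact hi (h' ▸ mem_supp.2 h)
    have h1 := w.1.2.1.2
    rw [hsum _ hzero] at h1
    ext i
    by_cases hi : i ∈ s
    · simp only [cellPoint, hi, dif_pos, hcons]
      rw [← Finset.sum_div, h1, e.apply_symm_apply, div_div_div_cancel_right₀ (hw0 w 0).ne',
        div_one]
    · simp only [cellPoint, hi, dif_neg, not_false_eq_true]
      exact (hzero i hi).symm
  · ext k
    simp only [hval]
    rw [Real.log_div (hE y _).ne' (hEsum y).ne', Real.log_div (hE y _).ne' (hEsum y).ne']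
    simp
  · have hcw : ∀ i, Continuous fun w : {w : geom K | supp (w : ι → ℝ) = s} => (w : ι → ℝ) i :=
      fun i => (continuous_apply i).comp (continuous_subtype_val.comp continuous_subtype_val)
    exact continuous_pi fun k =>
      ((hcw _).log fun w => (hw0 w _).ne').sub ((hcw _).log fun w => (hw0 w _).ne')
  · refine Continuous.subtype_mk (Continuous.subtype_mk (continuous_pi fun i => ?_) _) _
    have hcE : ∀ k, Continuous fun y : Fin d → ℝ =>
        (Fin.cons 1 (fun k => Real.exp (y k)) : Fin (d + 1) → ℝ) k := by
      intro k
      refine Fin.cases ?_ (fun k => ?_) k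
      · simpa using continuous_const
      · simpa using by fun_prop
    by_cases hi : i ∈ s
    · simp only [cellPoint, hi, dif_pos]
      exact (hcE _).div (continuous_finsetSum _ fun k _ => hcE k) fun y => (hEsum y).ne'
    · simp only [cellPoint, hi, dif_neg, not_false_eq_true]
      exact continuous_const

/-- The complement of the basepoint of a sphere is a euclidean space. -/
noncomputable def sphereComplHomeomorph (d : ℕ) :
    ({Sphere.basepoint d}ᶜ : Set (Sphere d)) ≃ₜ (Fin d → ℝ) :=
  haveI : Fact (Module.finrank ℝ (EuclideanSpace ℝ (Fin (d + 1))) = d + 1) := ⟨by simp⟩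
  let f := stereographic' d (Sphere.basepoint d)
  (Homeomorph.setCongr (stereographic'_source (n := d) (Sphere.basepoint d)).symm).trans <|
    f.toHomeomorphSourceTarget.trans <|
    (Homeomorph.setCongr (stereographic'_target (n := d) (Sphere.basepoint d))).trans <|
    (Homeomorph.Set.univ _).trans (EuclideanSpace.equiv (Fin d) ℝ).toHomeomorph

end Cells

/-! ### Complexes that are contractible up to some facets -/

section Facets

variable {ι : Type*} {J : Type*}

/-- The relative position of `w` between the boundary of `s` and its barycentre. -/
noncomputable def depth (s : Finset ι) (w : ι → ℝ) : ℝ :=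
  s.card * minCoord s w

theorem continuous_depth (s : Finset ι) : Continuous (depth s) :=
  continuous_const.mul (continuous_minCoord s)

variable [Fintype ι]

theorem depth_nonneg {w : ι → ℝ} (hw : w ∈ stdSimplex ℝ ι) (s : Finset ι) : 0 ≤ depth s w :=
  mul_nonneg (Nat.cast_nonneg _) (minCoord_nonneg hw.1 s)

theorem subset_supp_of_depth_ne_zero {w : ι → ℝ} (hw : w ∈ stdSimplex ℝ ι) {s : Finset ι}
    (h : depth s w ≠ 0) : s ⊆ supp w := by
  refine subset_supp_of_minCoord_pos (lt_of_le_of_ne (minCoord_nonneg hw.1 s) ?_)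
  intro h'
  simp [depth, ← h'] at h

theorem depth_pos {w : ι → ℝ} (hw : w ∈ stdSimplex ℝ ι) {s : Finset ι} (hs : s.Nonempty)
    (h : s ⊆ supp w) : 0 < depth s w :=
  mul_pos (Nat.cast_pos.2 hs.card_pos) (minCoord_pos_of_subset_supp hs hw.1 h)

/-- The part of the depth of `w` that is removed up to time `t`. -/
noncomputable def removed (s : Finset ι) (t : ℝ) (w : ι → ℝ) : ℝ :=
  min (t / 2) (depth s w)

/-- Push `w` radially away from the barycentres of the facets `s j`. -/
noncomputable def expand [Fintype J] [DecidableEq ι] (s : J → Finset ι) (t : ℝ) (w : ι → ℝ) (i : ι) : ℝ :=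
  (w i - ∑ j, removed (s j) t w * if i ∈ s j then ((s j).card : ℝ)⁻¹ else 0) /
    (1 - ∑ j, removed (s j) t w)

/-- Finitely many facets of a complex. -/
structure Facets (K : Set (Finset ι)) (s : J → Finset ι) : Prop where
  lower : IsLowerSet K
  mem : ∀ j, s j ∈ K
  nonempty : ∀ j, (s j).Nonempty
  injective : Function.Injective s
  maximal : ∀ j, ∀ ρ ∈ K, s j ⊆ ρ → ρ = s j

variable {K : Set (Finset ι)} {s : J → Finset ι}

/-- Maximality of the facets makes positive depth mean lying in the open facet, so at most one depth
is nonzero and the sums in `expand` have at most one nonzero term. -/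
theorem Facets.supp_eq (h : Facets K s) {w : ι → ℝ} (hw : w ∈ geom K) {j : J}
    (hj : depth (s j) w ≠ 0) : supp w = s j :=
  h.maximal j _ hw.2 (subset_supp_of_depth_ne_zero hw.1 hj)

theorem Facets.depth_eq_zero (h : Facets K s) {w : ι → ℝ} (hw : w ∈ geom K) {j k : J}
    (hj : depth (s j) w ≠ 0) (hk : k ≠ j) : depth (s k) w = 0 := by
  by_contra hk'
  exact hk (h.injective ((h.supp_eq hw hk').symm.trans (h.supp_eq hw hj)))

theorem Facets.removed_eq_zero (h : Facets K s) {w : ι → ℝ} (hw : w ∈ geom K) {j k : J}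
    (hj : depth (s j) w ≠ 0) (hk : k ≠ j) {t : ℝ} (ht : 0 ≤ t) : removed (s k) t w = 0 := by
  rw [removed, h.depth_eq_zero hw hj hk, min_eq_right (by linarith)]

theorem Facets.mem_base_iff (h : Facets K s) {w : ι → ℝ} (hw : w ∈ geom K) :
    w ∈ geom (K \ Set.range s) ↔ ∀ j, depth (s j) w = 0 := by
  constructor
  · intro hw' j
    by_contra hj
    exact hw'.2.2 ⟨j, (h.supp_eq hw hj).symm⟩
  · intro h0
    refine ⟨hw.1, hw.2, ?_⟩
    rintro ⟨j, hj⟩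
    exact (depth_pos hw.1 (h.nonempty j) hj.subset).ne' (h0 j)

variable [Fintype J]

/-- Keeps the denominator in `expand` at least `1 / 2`. Without the halving in `removed` it would
vanish at a barycentre at time 1, since the depth there is 1. -/
theorem Facets.sum_removed_le (h : Facets K s) {w : ι → ℝ} (hw : w ∈ geom K) {t : ℝ}
    (ht : t ∈ unitInterval) : ∑ j, removed (s j) t w ≤ t / 2 := by
  by_cases h0 : ∀ j, depth (s j) w = 0
  · have : ∀ j, removed (s j) t w = 0 := fun j => by
      rw [removed, h0, min_eq_right (by linarith [ht.1])]
    simp only [this, Finset.sum_const_zero]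
    linarith [ht.1]
  · push Not at h0
    obtain ⟨j, hj⟩ := h0
    rw [Finset.sum_eq_single j (fun k _ hk => h.removed_eq_zero hw hj hk ht.1) (by simp)]
    exact min_le_left _ _

variable [DecidableEq ι]

theorem Facets.expand_eq_self (h : Facets K s) {w : ι → ℝ} (hw : w ∈ geom (K \ Set.range s))
    {t : ℝ} (ht : 0 ≤ t) : expand s t w = w := by
  have : ∀ j, removed (s j) t w = 0 := fun j => by
    rw [removed, (h.mem_base_iff ⟨hw.1, hw.2.1⟩).1 hw, min_eq_right (by linarith)]
  ext i
  simp [expand, this]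

theorem expand_zero (s : J → Finset ι) {w : ι → ℝ} (hw : w ∈ stdSimplex ℝ ι) :
    expand s 0 w = w := by
  have : ∀ j, removed (s j) 0 w = 0 := fun j => by
    rw [removed, zero_div, min_eq_left (depth_nonneg hw _)]
  ext i
  simp [expand, this]

theorem Facets.expand_eq (h : Facets K s) {w : ι → ℝ} (hw : w ∈ geom K) {j : J}
    (hj : depth (s j) w ≠ 0) {t : ℝ} (ht : 0 ≤ t) (i : ι) :
    expand s t w i = (w i - removed (s j) t w * if i ∈ s j then ((s j).card : ℝ)⁻¹ else 0) /
      (1 - removed (s j) t w) := by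
  rw [expand, Finset.sum_eq_single j (fun k _ hk => ?_) (by simp),
    Finset.sum_eq_single j (fun k _ hk => h.removed_eq_zero hw hj hk ht) (by simp)]
  rw [h.removed_eq_zero hw hj hk ht, zero_mul]

/-- At most the depth times the barycentre is subtracted, hence at most the least coordinate from
each coordinate; dividing by the remaining mass restores the sum 1. -/
theorem Facets.expand_mem (h : Facets K s) {w : ι → ℝ} (hw : w ∈ geom K) {t : ℝ}
    (ht : t ∈ unitInterval) : expand s t w ∈ geom K := by
  by_cases h0 : ∀ j, depth (s j) w = 0
  · rw [h.expand_eq_self ((h.mem_base_iff hw).2 h0) ht.1]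
    exact hw
  · push Not at h0
    obtain ⟨j, hj⟩ := h0
    have hc : (0 : ℝ) < (s j).card := Nat.cast_pos.2 (h.nonempty j).card_pos
    have hr : removed (s j) t w ≤ 1 / 2 := (min_le_left _ _).trans (by linarith [ht.2])
    have hr' : removed (s j) t w ≤ depth (s j) w := min_le_right _ _
    have hr0 : 0 < 1 - removed (s j) t w := by linarith
    have hsupp := h.supp_eq hw hj
    refine ⟨⟨fun i => ?_, ?_⟩, h.lower (fun i hi => ?_) (h.mem j)⟩
    · rw [h.expand_eq hw hj ht.1]
      refine div_nonneg ?_ hr0.le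
      split_ifs with hi
      · have h1 := minCoord_le hi w
        rw [depth] at hr'
        rw [sub_nonneg, mul_inv_le_iff₀ hc]
        nlinarith
      · simpa using hw.1.1 i
    · simp only [h.expand_eq hw hj ht.1]
      rw [← Finset.sum_div, Finset.sum_sub_distrib, hw.1.2, ← Finset.mul_sum,
        Finset.sum_ite_mem, Finset.univ_inter, Finset.sum_const, nsmul_eq_mul,
        mul_inv_cancel₀ hc.ne', mul_one, div_self hr0.ne']
    · by_contra hij
      rw [mem_supp, h.expand_eq hw hj ht.1] at hi
      have : w i = 0 := by
        by_contra hwi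
        exact hij (hsupp ▸ mem_supp.2 hwi)
      simp [hij, this] at hi

/-- Once `t / 2` reaches the depth, the coordinate that attains the minimum has become 0, so the
point has arrived at the boundary of its facet. -/
theorem Facets.expand_mem_base (h : Facets K s) {w : ι → ℝ} (hw : w ∈ geom K) {t : ℝ}
    (ht : t ∈ unitInterval) (hwt : 2 * ∑ j, depth (s j) w ≤ t) :
    expand s t w ∈ geom (K \ Set.range s) := by
  by_cases h0 : ∀ j, depth (s j) w = 0
  · have := (h.mem_base_iff hw).2 h0
    rwa [h.expand_eq_self this ht.1]
  · push Not at h0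
    obtain ⟨j, hj⟩ := h0
    have hmem := h.expand_mem hw ht
    refine ⟨hmem.1, hmem.2, ?_⟩
    rintro ⟨k, hk⟩
    have hsupp := h.supp_eq hw hj
    have hsub : supp (expand s t w) ⊆ s j := by
      intro i hi
      by_contra hij
      rw [mem_supp, h.expand_eq hw hj ht.1] at hi
      have : w i = 0 := by
        by_contra hwi
        exact hij (hsupp ▸ mem_supp.2 hwi)
      simp [hij, this] at hi
    have hkj : s j = s k := h.maximal k _ (h.mem j) (hk ▸ hsub)
    obtain ⟨i, hi, e⟩ := exists_eq_minCoord (h.nonempty j) w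
    have hi' : i ∈ supp (expand s t w) := by rw [← hk, ← hkj]; exact hi
    rw [mem_supp, h.expand_eq hw hj ht.1] at hi'
    rw [Finset.sum_eq_single j (fun k _ hk => h.depth_eq_zero hw hj hk) (by simp)] at hwt
    have hc : (0 : ℝ) < (s j).card := Nat.cast_pos.2 (h.nonempty j).card_pos
    refine hi' ?_
    rw [removed, min_eq_right (by linarith), if_pos hi, e, depth]
    field_simp
    simp

theorem Facets.continuous_expand (h : Facets K s) :
    Continuous fun p : unitInterval × geom K => expand s p.1 (p.2 : ι → ℝ) := by
  have hr : ∀ j, Continuous fun p : unitInterval × geom K => removed (s j) p.1 p.2 := by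
    intro j
    have := continuous_depth (s j)
    unfold removed
    fun_prop
  refine continuous_pi fun i => Continuous.div ?_ ?_ ?_
  · have : Continuous fun p : unitInterval × geom K => (p.2 : ι → ℝ) i :=
      (continuous_apply i).comp (continuous_subtype_val.comp continuous_snd)
    exact this.sub (continuous_finsetSum _ fun j _ => (hr j).mul continuous_const)
  · exact continuous_const.sub (continuous_finsetSum _ fun j _ => hr j)
  · intro p
    have := h.sum_removed_le p.2.2 p.1.2
    have := p.1.2.2
    linarith

/-- A contraction of the complement of some open facets extends to the whole complex. -/
theorem Facets.exists_extension (h : Facets K s) [ContractibleSpace (geom (K \ Set.range s))] :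
    ∃ Φ : unitInterval × geom K → geom K, Continuous Φ ∧ (∀ x, Φ (0, x) = x) ∧
      (∀ t, ∀ a : geom K, (a : ι → ℝ) ∈ geom (K \ Set.range s) →
        (Φ (t, a) : ι → ℝ) ∈ geom (K \ Set.range s)) ∧
      ∃ p, ∀ a : geom K, (a : ι → ℝ) ∈ geom (K \ Set.range s) → Φ (1, a) = p := by
  classical
  obtain ⟨a₀, ⟨H⟩⟩ := (contractible_iff_id_nullhomotopic _).1
    (inferInstance : ContractibleSpace (geom (K \ Set.range s)))
  let inc : geom (K \ Set.range s) → geom K := fun w => ⟨w, w.2.1, w.2.2.1⟩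
  have hinc : Continuous inc := continuous_subtype_val.subtype_mk _
  let m : geom K → ℝ := fun w => ∑ j, depth (s j) (w : ι → ℝ)
  have hm : Continuous m :=
    continuous_finsetSum _ fun j _ => (continuous_depth _).comp continuous_subtype_val
  have hm0 : ∀ w, 0 ≤ m w := fun w => Finset.sum_nonneg fun j _ => depth_nonneg w.2.1 _
  let R : unitInterval × geom K → geom K := fun p => ⟨expand s p.1 p.2, h.expand_mem p.2.2 p.1.2⟩
  have hR : Continuous R := h.continuous_expand.subtype_mk _
  -- A point of an open facet moves radially until it hits the boundary at time `2 * m`, which is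
  -- the region `Q`. From then on, in `P`, it follows the contraction `H`, whose clock `τ` starts at
  -- the moment of arrival.
  let P : Set (unitInterval × geom K) := {p | 2 * m p.2 ≤ p.1}
  let Q : Set (unitInterval × geom K) := {p | (p.1 : ℝ) ≤ 2 * m p.2}
  have hP : IsClosed P := isClosed_le (by fun_prop) (by fun_prop)
  have hQ : IsClosed Q := isClosed_le (by fun_prop) (by fun_prop)
  let τ : unitInterval × geom K → unitInterval := fun p =>
    Set.projIcc 0 1 (zero_le_one (α := ℝ)) ((p.1 : ℝ) - 2 * m p.2)
  have hτ : Continuous τ := continuous_projIcc.comp (by fun_prop)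
  let F : P → geom K := fun p => inc (H (τ p, ⟨R p, h.expand_mem_base p.1.2.2 p.1.1.2 p.2⟩))
  have hF : Continuous F := by
    refine hinc.comp (H.continuous.comp ?_)
    exact (hτ.comp continuous_subtype_val).prodMk
      ((continuous_subtype_val.comp (hR.comp continuous_subtype_val)).subtype_mk _)
  let Φ : unitInterval × geom K → geom K := fun p => if hp : p ∈ P then F ⟨p, hp⟩ else R p
  have hΦP : ∀ p (hp : p ∈ P), Φ p = F ⟨p, hp⟩ := fun p hp => dif_pos hp
  have hFR : ∀ p (hp : p ∈ P), (p.1 : ℝ) = 2 * m p.2 → F ⟨p, hp⟩ = R p := by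
    intro p hp e
    have : τ p = 0 := by
      simp only [τ, e, sub_self]
      exact Set.projIcc_left _
    simp only [F, this, H.apply_zero]
    rfl
  have hΦQ : ∀ p ∈ Q, Φ p = R p := by
    intro p hp
    by_cases hp' : p ∈ P
    · rw [hΦP p hp']
      exact hFR p hp' (le_antisymm hp hp')
    · exact dif_neg hp'
  have hmA : ∀ a : geom K, (a : ι → ℝ) ∈ geom (K \ Set.range s) → m a = 0 := fun a ha =>
    Finset.sum_eq_zero fun j _ => (h.mem_base_iff a.2).1 ha j
  refine ⟨Φ, ?_, ?_, ?_, inc a₀, ?_⟩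
  · have hcov : P ∪ Q = Set.univ := Set.eq_univ_of_forall fun p => le_total (2 * m p.2) (p.1 : ℝ)
    rw [← continuousOn_univ, ← hcov]
    refine ContinuousOn.union_of_isClosed ?_ ?_ hP hQ
    · rw [continuousOn_iff_continuous_domRestrict]
      convert hF using 1
      ext1 p
      exact hΦP p p.2
    · exact hR.continuousOn.congr hΦQ
  · intro x
    have hx : ((0 : unitInterval), x) ∈ Q := by
      have := hm0 x
      simp only [Q, Set.mem_ofPred_eq, Set.Icc.coe_zero]
      linarith
    rw [hΦQ _ hx]
    exact Subtype.ext (expand_zero s x.2.1)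
  · intro t a ha
    have hp : (t, a) ∈ P := by
      simp only [P, Set.mem_ofPred_eq, hmA a ha, mul_zero]
      exact t.2.1
    rw [hΦP _ hp]
    exact Subtype.coe_prop _
  · intro a ha
    have hp : ((1 : unitInterval), a) ∈ P := by
      simp only [P, Set.mem_ofPred_eq, hmA a ha, mul_zero]
      exact zero_le_one
    rw [hΦP _ hp]
    have : τ (1, a) = 1 := by
      simp only [τ, hmA a ha, mul_zero, sub_zero]
      exact Set.projIcc_right _
    simp only [F, this, H.apply_one]
    rfl

/-- A complex that becomes contractible when some open facets are removed is homotopy equivalent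
to a wedge of spheres, one for each of these facets. -/
theorem Facets.nonempty_homotopyEquiv_wedge (h : Facets K s)
    [ContractibleSpace (geom (K \ Set.range s))] (d : J → ℕ) (hd : ∀ j, (s j).card = d j + 1) :
    Nonempty (ContinuousMap.HomotopyEquiv (geom K)
      (Wedge fun j => Sphere.basepoint (d j))) := by
  have : CompactSpace (geom K) := isCompact_iff_compactSpace.1 (isCompact_geom h.lower)
  let O : J → Set (geom K) := fun j => {w | supp (w : ι → ℝ) = s j}
  let C : J → Set (geom K) := fun j => {w | supp (w : ι → ℝ) ⊆ s j}
  have hOdepth : ∀ j (w : geom K), w ∈ O j ↔ depth (s j) (w : ι → ℝ) ≠ 0 := fun j w =>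
    ⟨fun hw => (depth_pos w.2.1 (h.nonempty j) (Eq.superset hw)).ne', h.supp_eq w.2⟩
  have hO : ∀ j, IsOpen (O j) := fun j => by
    have : O j = {w : geom K | depth (s j) (w : ι → ℝ) ≠ 0} := Set.ext (hOdepth j)
    rw [this]
    exact isOpen_ne_fun ((continuous_depth _).comp continuous_subtype_val) continuous_const
  have hC : ∀ j, IsClosed (C j) := fun j => by
    have : C j = ⋂ i, ⋂ (_ : i ∉ s j), {w : geom K | (w : ι → ℝ) i = 0} := by
      ext w
      simp only [C, Set.mem_ofPred_eq, Set.mem_iInter, Finset.subset_iff, mem_supp]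
      exact forall_congr' fun i => not_imp_comm
    rw [this]
    exact isClosed_iInter fun i => isClosed_iInter fun _ =>
      isClosed_eq ((continuous_apply i).comp continuous_subtype_val) continuous_const
  have hbase : ∀ w : geom K, w ∈ (⋃ j, O j)ᶜ ↔ (w : ι → ℝ) ∈ geom (K \ Set.range s) := by
    intro w
    rw [h.mem_base_iff w.2]
    simp [hOdepth]
  let f : ∀ j, O j ≃ₜ ({Sphere.basepoint (d j)}ᶜ : Set (Sphere (d j))) := fun j =>
    (cellHomeomorph (h.mem j) ((s j).equivFinOfCardEq (hd j)).symm).trans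
      (sphereComplHomeomorph (d j)).symm
  choose c hc hcO hcb using fun j => exists_continuous_collapse _ (hO j) (f j)
  obtain ⟨Φ, hΦ, h0, hA, p, h1⟩ := h.exists_extension
  obtain ⟨a₀⟩ := (inferInstance : Nonempty (geom (K \ Set.range s)))
  have hdisj : ∀ j k, j ≠ k → Disjoint (O j) (C k) := by
    intro j k hjk
    rw [Set.disjoint_left]
    intro w hw hw'
    have hw : supp (w : ι → ℝ) = s j := hw
    have hw' : supp (w : ι → ℝ) ⊆ s k := hw'
    exact hjk (h.injective (h.maximal j _ (h.mem k) (hw ▸ hw'))).symm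
  have hinj : ∀ j, Set.InjOn (c j) (O j) := by
    intro j x hx y hy hxy
    have e : (f j ⟨x, hx⟩ : Sphere (d j)) = f j ⟨y, hy⟩ := by
      rw [← hcO j ⟨x, hx⟩, ← hcO j ⟨y, hy⟩]
      exact hxy
    exact congrArg Subtype.val ((f j).injective (Subtype.ext e))
  have himg : ∀ j, c j '' O j = {Sphere.basepoint (d j)}ᶜ := by
    intro j
    ext z
    constructor
    · rintro ⟨x, hx, rfl⟩
      rw [hcO j ⟨x, hx⟩]
      exact (f j ⟨x, hx⟩).2
    · intro hz
      refine ⟨(f j).symm ⟨z, hz⟩, ((f j).symm ⟨z, hz⟩).2, ?_⟩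
      rw [hcO j, (f j).apply_symm_apply]
  obtain ⟨q, hq, hfib, hqA⟩ := exists_isQuotientMap_wedge (fun j => Sphere.basepoint (d j)) c hc
    O C hO hC (fun j w hw => Eq.subset hw) hdisj hcb hinj himg
    ⟨⟨a₀, a₀.2.1, a₀.2.2.1⟩, (hbase _).2 a₀.2⟩
  refine nonempty_homotopyEquiv_of_isQuotientMap hq hfib hqA hΦ h0 ?_ ?_
  · exact fun t a ha => (hbase _).2 (hA t a ((hbase a).1 ha))
  · exact fun a ha b hb => (h1 a ((hbase a).1 ha)).trans (h1 b ((hbase b).1 hb)).symm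

end Facets

/-! ### Rooted trees -/

section Rooting

variable {V : Type*} {T : SimpleGraph V}

/-- A description of the graph `T` as a tree with root `v`. -/
structure Rooting (T : SimpleGraph V) (v : V) where
  /-- The parent of a vertex other than the root. -/
  par : V → V
  /-- The distance to the root. -/
  ht : V → ℕ
  ht_par : ∀ x, x ≠ v → ht (par x) < ht x
  cases : ∀ x y, T.Adj x y → x ≠ v ∧ par x = y ∨ y ≠ v ∧ par y = x

/-- The height is the distance to `v`, and the parent is the last vertex but one on the path from
`v`. Adjacent vertices of a tree have distances that differ by exactly 1, so every edge joins a
vertex to its parent. -/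
theorem exists_rooting (hT : T.IsTree) (v : V) : Nonempty (Rooting T v) := by
  classical
  have hpen : ∀ x y, T.Adj y x → T.dist v x = T.dist v y + 1 →
      ((hT.existsUnique_path v x).choose.penultimate) = y := by
    intro x y h hd
    obtain ⟨p, hp⟩ := hT.connected.exists_walk_length_eq_dist v y
    have hq : (p.concat h).IsPath := by
      refine SimpleGraph.Walk.isPath_of_length_eq_dist _ ?_
      rw [SimpleGraph.Walk.length_concat, hp, hd]
    rw [← (hT.existsUnique_path v x).choose_spec.2 _ hq]
    simp
  have hne : ∀ x y, T.dist v x = T.dist v y + 1 → x ≠ v := by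
    rintro x y h rfl
    simp at h
  refine ⟨⟨fun x => (hT.existsUnique_path v x).choose.penultimate, fun x => T.dist v x, ?_, ?_⟩⟩
  · intro x hx
    have hnil : ¬ (hT.existsUnique_path v x).choose.Nil :=
      SimpleGraph.Walk.not_nil_of_ne hx.symm
    have hadj := SimpleGraph.Walk.adj_penultimate hnil
    rcases hT.dist_eq_dist_add_one_of_adj v hadj with h | h
    · have e := hpen _ _ hadj.symm h
      generalize hp : (hT.existsUnique_path v x).choose = p at *
      have hpath : p.IsPath := hp ▸ (hT.existsUnique_path v x).choose_spec.1
      have h1 : T.dist v p.penultimate ≤ p.dropLast.length := SimpleGraph.dist_le _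
      have h2 : p.length = T.dist v x := by
        obtain ⟨q, hq⟩ := hT.connected.exists_walk_length_eq_dist v x
        have hqp : q.IsPath := SimpleGraph.Walk.isPath_of_length_eq_dist _ hq
        rw [← (hT.existsUnique_path v x).unique hqp hpath, hq]
      have h3 : p.dropLast.length ≤ p.length := by simp
      omega
    · simp only
      omega
  · intro x y hxy
    rcases hT.dist_eq_dist_add_one_of_adj v hxy with h | h
    · exact .inl ⟨hne _ _ h, hpen _ _ hxy.symm h⟩
    · exact .inr ⟨hne _ _ h, hpen _ _ hxy h⟩

variable {v : V}

theorem Rooting.par_eq (R : Rooting T v) {w : V} (h : T.Adj v w) : w ≠ v ∧ R.par w = v := by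
  rcases R.cases v w h with h | h
  · exact absurd rfl h.1
  · exact h

theorem Rooting.par_par_ne (R : Rooting T v) {x : V} (hx : x ≠ v) (hp : R.par x ≠ v) :
    R.par (R.par x) ≠ x := fun h => by
  have h1 := R.ht_par _ hx
  have h2 := R.ht_par _ hp
  rw [h] at h2
  omega

end Rooting

/-! ### Edge sets of directed forests -/

section Families

variable {V : Type*} {T : SimpleGraph V}

/-- The edge sets of directed forests in the double directed graph of the forest `H`. -/
def forestFamily (H : T.Subgraph) : Set (Finset (V × V)) :=
  {F | (∀ e ∈ F, H.Adj e.1 e.2) ∧ (∀ a b c, (a, c) ∈ F → (b, c) ∈ F → a = b) ∧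
    ∀ a b, (a, b) ∈ F → (b, a) ∉ F}

theorem isLowerSet_forestFamily (H : T.Subgraph) : IsLowerSet (forestFamily H) := by
  rintro F F' hF ⟨h1, h2, h3⟩
  exact ⟨fun e he => h1 e (hF he), fun a b c ha hb => h2 a b c (hF ha) (hF hb),
    fun a b h h' => h3 a b (hF h) (hF h')⟩

theorem insert_mem_forestFamily [DecidableEq V] {H : T.Subgraph} {F : Finset (V × V)}
    (hF : F ∈ forestFamily H) {a b : V} (hab : H.Adj a b) (h1 : ∀ c, (c, b) ∈ F → c = a)
    (h2 : (b, a) ∉ F) : insert (a, b) F ∈ forestFamily H := by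
  refine ⟨?_, ?_, ?_⟩
  · intro e he
    rcases Finset.mem_insert.1 he with rfl | he
    · exact hab
    · exact hF.1 e he
  · intro x y z hx hy
    rw [Finset.mem_insert, Prod.mk.injEq] at hx hy
    rcases hx with ⟨rfl, rfl⟩ | hx <;> rcases hy with ⟨rfl, hy⟩ | hy
    · rfl
    · exact (h1 _ hy).symm
    · subst hy; exact h1 _ hx
    · exact hF.2.1 _ _ _ hx hy
  · intro x y hx hy
    rw [Finset.mem_insert, Prod.mk.injEq] at hx hy
    rcases hx with ⟨rfl, rfl⟩ | hx <;> rcases hy with ⟨h, h'⟩ | hy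
    · subst h; exact H.loopless.irrefl _ hab
    · exact h2 hy
    · subst h h'; exact h2 hx
    · exact hF.2.2 _ _ hx hy

end Families

/-! ### Partial choices of leaves -/

section Partial

variable {V : Type*} {T : SimpleGraph V} {v : V}

/-- `x` is the head of an edge in `S`. -/
def Head (S : Finset (V × V)) (x : V) : Prop :=
  ∃ y, (y, x) ∈ S

/-- `S` consists of the edge `(v, w)` and of edges `(y, x)`, where `y` is the child chosen to be a
leaf at the vertex `x`, whose parent has to be a vertex with a choice other than `x`. -/
structure IsPartial (R : Rooting T v) (H : T.Subgraph) (w : V) (S : Finset (V × V)) : Prop where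
  base : (v, w) ∈ S
  adj : ∀ y x, (y, x) ∈ S → H.Adj y x
  par : ∀ y x, (y, x) ∈ S → y = v ∧ x = w ∨ y ≠ v ∧ R.par y = x
  inj : ∀ a b c, (a, c) ∈ S → (b, c) ∈ S → a = b
  head_ne : ∀ x, Head S x → x ≠ v
  up : ∀ x, Head S x → x ≠ w → Head S (R.par x) ∧ (x, R.par x) ∉ S ∧ H.Adj x (R.par x)

/-- A choice has still to be made at the vertex `x`. -/
structure IsPending (R : Rooting T v) (H : T.Subgraph) (S : Finset (V × V)) (x : V) : Prop where
  ne : x ≠ v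
  head : Head S (R.par x)
  notMem : (x, R.par x) ∉ S
  adj : H.Adj x (R.par x)
  not_head : ¬ Head S x

/-- All choices have been made. -/
structure IsComplete (R : Rooting T v) (H : T.Subgraph) (w : V) (S : Finset (V × V)) : Prop
    extends IsPartial R H w S where
  not_pending : ∀ x, ¬ IsPending R H S x

variable {R : Rooting T v} {H : T.Subgraph} {w : V} {S S' F : Finset (V × V)}

theorem IsPending.ne_base {x : V} (hx : IsPending R H S x) (hS : IsPartial R H w S) : x ≠ w := by
  rintro rfl
  exact hx.not_head ⟨_, hS.base⟩

theorem IsPartial.par_base (hS : IsPartial R H w S) : w ≠ v ∧ R.par w = v :=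
  R.par_eq (hS.adj _ _ hS.base).adj_sub

/-- Heads and tails are disjoint; they are to become the non-leaves and the leaves of a basic tree.
-/
theorem IsPartial.not_head_of_mem (hS : IsPartial R H w S) {y x : V} (h : (y, x) ∈ S) :
    ¬ Head S y := by
  intro hy
  rcases hS.par _ _ h with ⟨rfl, -⟩ | ⟨hyv, rfl⟩
  · exact hS.head_ne _ hy rfl
  · by_cases hw : y = w
    · subst hw
      exact hS.head_ne _ ⟨_, h⟩ hS.par_base.2
    · exact (hS.up y hy hw).2.1 h

theorem IsPartial.eq_of_mem_of_mem (hS : IsPartial R H w S) {y x x' : V} (h : (y, x) ∈ S)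
    (h' : (y, x') ∈ S) : x = x' := by
  rcases hS.par _ _ h with ⟨rfl, rfl⟩ | ⟨hy, rfl⟩ <;>
    rcases hS.par _ _ h' with ⟨hy', rfl⟩ | ⟨hy', rfl⟩
  · rfl
  · exact absurd rfl hy'
  · exact absurd hy' hy
  · rfl

/-- Induction on the height. The parent of `x` is already a head of `S'`, and its incoming edge in
`F` is unique, so `S` and `S'` chose the same child there. This child is not `x`, so `x` would be
pending for `S'` if it were not a head. -/
theorem IsComplete.head_of_partial (hS' : IsComplete R H w S') (hS : IsPartial R H w S)
    (hF : F ∈ forestFamily H) (h : S ⊆ F) (h' : S' ⊆ F) (x : V)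
    (hx : Head S x ∨ IsPending R H S x) : Head S' x := by
  induction hn : R.ht x using Nat.strong_induction_on generalizing x with
  | _ n ih =>
    subst hn
    by_cases hxw : x = w
    · subst hxw
      exact ⟨_, hS'.base⟩
    · have hxv : x ≠ v := hx.elim (hS.head_ne x) (·.ne)
      have key : Head S (R.par x) ∧ (x, R.par x) ∉ S ∧ H.Adj x (R.par x) :=
        hx.elim (hS.up x · hxw) fun hx => ⟨hx.head, hx.notMem, hx.adj⟩
      have hpar : Head S' (R.par x) := ih _ (R.ht_par x hxv) _ (.inl key.1) rfl
      by_contra hn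
      refine hS'.not_pending x ⟨hxv, hpar, fun hmem => ?_, key.2.2, hn⟩
      obtain ⟨z, hz⟩ := key.1
      exact key.2.1 (hF.2.1 _ _ _ (h hz) (h' hmem) ▸ hz)

theorem IsComplete.subset_of_partial (hS' : IsComplete R H w S') (hS : IsPartial R H w S)
    (hF : F ∈ forestFamily H) (h : S ⊆ F) (h' : S' ⊆ F) : S ⊆ S' := by
  rintro ⟨y, x⟩ hyx
  obtain ⟨z, hz⟩ := hS'.head_of_partial hS hF h h' x (.inl ⟨y, hyx⟩)
  rwa [hF.2.1 _ _ _ (h hyx) (h' hz)]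

/-- A forest thus determines the complete choice inside it, which lets the first basic tree be
recovered from a facet. -/
theorem IsComplete.eq_of_subset (hS : IsComplete R H w S) (hS' : IsComplete R H w S')
    (hF : F ∈ forestFamily H) (h : S ⊆ F) (h' : S' ⊆ F) : S = S' :=
  (hS'.subset_of_partial hS.toIsPartial hF h h').antisymm
    (hS.subset_of_partial hS'.toIsPartial hF h' h)

theorem IsPartial.singleton (R : Rooting T v) (h : H.Adj v w) : IsPartial R H w {(v, w)} where
  base := by simp
  adj := by rintro y x hx; simp only [Finset.mem_singleton, Prod.mk.injEq] at hx; simpa [hx]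
  par := by rintro y x hx; simp only [Finset.mem_singleton, Prod.mk.injEq] at hx; exact .inl hx
  inj := by
    rintro a b c ha hb
    simp only [Finset.mem_singleton, Prod.mk.injEq] at ha hb
    rw [ha.1, hb.1]
  head_ne := by
    rintro x ⟨y, hx⟩
    simp only [Finset.mem_singleton, Prod.mk.injEq] at hx
    rw [hx.2]
    exact (R.par_eq h.adj_sub).1
  up := by
    rintro x ⟨y, hx⟩
    simp only [Finset.mem_singleton, Prod.mk.injEq] at hx
    exact fun hne => absurd hx.2 hne

variable [DecidableEq V]

theorem IsPartial.insert (hS : IsPartial R H w S) {x y : V} (hx : IsPending R H S x)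
    (hyx : H.Adj y x) (hy : y ≠ R.par x) : IsPartial R H w (insert (y, x) S) where
  base := Finset.mem_insert_of_mem hS.base
  adj := by
    rintro a b h
    rw [Finset.mem_insert, Prod.mk.injEq] at h
    rcases h with ⟨rfl, rfl⟩ | h
    · exact hyx
    · exact hS.adj _ _ h
  par := by
    rintro a b h
    rw [Finset.mem_insert, Prod.mk.injEq] at h
    rcases h with ⟨rfl, rfl⟩ | h
    · exact .inr ((R.cases _ _ hyx.adj_sub).resolve_right fun h => hy h.2.symm)
    · exact hS.par _ _ h
  inj := by
    rintro a b c ha hb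
    rw [Finset.mem_insert, Prod.mk.injEq] at ha hb
    rcases ha with ⟨rfl, rfl⟩ | ha <;> rcases hb with ⟨rfl, hb⟩ | hb
    · rfl
    · exact absurd ⟨_, hb⟩ hx.not_head
    · subst hb; exact absurd ⟨_, ha⟩ hx.not_head
    · exact hS.inj _ _ _ ha hb
  head_ne := by
    rintro a ⟨b, h⟩
    rw [Finset.mem_insert, Prod.mk.injEq] at h
    rcases h with ⟨rfl, rfl⟩ | h
    · exact hx.ne
    · exact hS.head_ne _ ⟨_, h⟩
  up := by
    rintro a ⟨b, h⟩ haw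
    rw [Finset.mem_insert, Prod.mk.injEq] at h
    have hmono : ∀ z, Head S z → Head (Insert.insert (y, x) S) z :=
      fun z ⟨u, hu⟩ => ⟨u, Finset.mem_insert_of_mem hu⟩
    rw [Finset.mem_insert, Prod.mk.injEq, not_or]
    rcases h with ⟨rfl, rfl⟩ | h
    · exact ⟨hmono _ hx.head, ⟨fun h => H.loopless.irrefl _ (h.1 ▸ hyx), hx.notMem⟩, hx.adj⟩
    · have h' := hS.up a ⟨b, h⟩ haw
      exact ⟨hmono _ h'.1, ⟨fun h => hx.not_head (h.2 ▸ h'.1), h'.2.1⟩, h'.2.2⟩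

/-- If the families above all complete choices are collapsible, then so is everything. -/
theorem collapsible_of_isComplete [Fintype V] (R : Rooting T v) (hvw : H.Adj v w)
    (hleaf : ∀ y, H.Adj v y → y = w) {C : Set (Finset (V × V))}
    (hC : ∀ F ∈ C, ∃ S, IsComplete R H w S ∧ S ⊆ F)
    (hcol : ∀ S, IsComplete R H w S → Collapsible {F ∈ forestFamily H \ C | S ⊆ F}) :
    Collapsible (forestFamily H \ C) := by
  classical
  have main : ∀ S, IsPartial R H w S → Collapsible {F ∈ forestFamily H \ C | S ⊆ F} := by
    intro S hS
    induction hn : Fintype.card (V × V) - S.card using Nat.strong_induction_on generalizing S with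
    | _ n ih =>
    subst hn
    by_cases hpend : ∀ x, ¬ IsPending R H S x
    · exact hcol S ⟨hS, hpend⟩
    push Not at hpend
    obtain ⟨x, hx⟩ := hpend
    obtain ⟨z, hz⟩ := hx.head
    have hpx : R.par (R.par x) ≠ x := R.par_par_ne hx.ne (hS.head_ne _ hx.head)
    -- The edges that enter `x` from its children; a forest contains at most one of them.
    let Y : Finset (V × V) :=
      Finset.univ.filter fun e => e.2 = x ∧ H.Adj e.1 x ∧ e.1 ≠ R.par x
    -- A member of `C` would contain a complete choice with head `x`, hence an element of `Y`. So
    -- the part that avoids `Y` also avoids `C`, and the cone below is not damaged by removing `C`.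
    have hY : ∀ e, e ∈ Y ↔ e.2 = x ∧ H.Adj e.1 x ∧ e.1 ≠ R.par x := by simp [Y]
    have hnotC : ∀ G ∈ forestFamily H, S ⊆ G → (∀ a ∈ Y, a ∉ G) → G ∉ C := by
      intro G hG hSG hGY hGC
      obtain ⟨S', hS', hS'G⟩ := hC G hGC
      obtain ⟨y, hy⟩ := hS'.head_of_partial hS hG hSG hS'G x (.inr hx)
      refine hGY (y, x) ((hY _).2 ⟨rfl, hS'.adj _ _ hy, ?_⟩) (hS'G hy)
      rintro rfl
      rcases hS'.par _ _ hy with ⟨-, h⟩ | ⟨-, h⟩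
      · exact hx.ne_base hS h
      · exact hpx h
    refine Collapsible.of_branches Y ?_ ?_ ?_
    · rintro F ⟨⟨hF, -⟩, -⟩ ⟨a, b⟩ ha ⟨a', b'⟩ ha' h h'
      obtain rfl : b = x := ((hY _).1 ha).1
      obtain rfl : b' = b := ((hY _).1 ha').1
      rw [hF.2.1 _ _ _ h h']
    -- Nothing else enters `x`, and the opposite edge is excluded because `S` already contains an
    -- edge `(z, R.par x)` with `z ≠ x`.
    · refine Collapsible.of_cone (R.par x, x) _ ?_ ?_
      · rintro F ⟨⟨⟨hF, -⟩, hSF⟩, hFY⟩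
        have h1 : insert (R.par x, x) F ∈ forestFamily H := by
          refine insert_mem_forestFamily hF hx.adj.symm (fun c hc => ?_) fun h => ?_
          · by_contra hne
            exact hFY (c, x) ((hY _).2 ⟨rfl, hF.1 _ hc, hne⟩) hc
          · exact hx.notMem (hF.2.1 _ _ _ h (hSF hz) ▸ hz)
        have h2 : S ⊆ insert (R.par x, x) F := hSF.trans (Finset.subset_insert _ _)
        have h3 : ∀ a ∈ Y, a ∉ insert (R.par x, x) F := by
          intro a ha h
          rcases Finset.mem_insert.1 h with rfl | h
          · exact ((hY _).1 ha).2.2 rfl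
          · exact hFY a ha h
        exact ⟨⟨⟨h1, hnotC _ h1 h2 h3⟩, h2⟩, h3⟩
      · rintro F ⟨⟨⟨hF, -⟩, hSF⟩, hFY⟩
        have h1 : F.erase (R.par x, x) ∈ forestFamily H :=
          isLowerSet_forestFamily H (Finset.erase_subset _ _) hF
        have h2 : S ⊆ F.erase (R.par x, x) := fun e he =>
          Finset.mem_erase.2 ⟨fun h => hx.not_head ⟨_, h ▸ he⟩, hSF he⟩
        have h3 : ∀ a ∈ Y, a ∉ F.erase (R.par x, x) := fun a ha h =>
          hFY a ha (Finset.mem_of_mem_erase h)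
        exact ⟨⟨⟨h1, hnotC _ h1 h2 h3⟩, h2⟩, h3⟩
    · rintro ⟨y, x'⟩ hyx
      obtain ⟨rfl, hadj, hne⟩ := (hY _).1 hyx
      have hnot : (y, x') ∉ S := fun h => hx.not_head ⟨_, h⟩
      have hcard : (insert (y, x') S).card = S.card + 1 := Finset.card_insert_of_notMem hnot
      have hle := Finset.card_le_univ (insert (y, x') S)
      have := ih _ (by omega) (insert (y, x') S) (hS.insert hx hadj hne) rfl
      convert this using 1
      ext F
      simp only [Set.mem_ofPred_eq, Finset.insert_subset_iff, and_assoc]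
      tauto
  refine Collapsible.of_split (fun F => (v, w) ∈ F) ?_ ?_ fun σ _ ρ _ h1 h2 => h2 h1
  · simpa using main _ (IsPartial.singleton R hvw)
  · have hnotC : ∀ F, (v, w) ∉ F → F ∉ C := by
      intro F hF hFC
      obtain ⟨S, hS, hSF⟩ := hC F hFC
      exact hF (hSF hS.base)
    -- Only `w` can send an edge to the leaf `v`, and the opposite edge `(v, w)` is absent.
    refine Collapsible.of_cone (w, v) _ ?_ ?_
    · rintro F ⟨⟨hF, -⟩, hFv⟩
      have h1 : (v, w) ∉ insert (w, v) F := by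
        rw [Finset.mem_insert, Prod.mk.injEq, not_or]
        exact ⟨fun h => H.loopless.irrefl _ (h.1 ▸ hvw), hFv⟩
      exact ⟨⟨insert_mem_forestFamily hF hvw.symm (fun c hc => hleaf c (hF.1 _ hc).symm) hFv,
        hnotC _ h1⟩, h1⟩
    · rintro F ⟨⟨hF, -⟩, hFv⟩
      have h1 : (v, w) ∉ F.erase (w, v) := fun h => hFv (Finset.mem_of_mem_erase h)
      exact ⟨⟨isLowerSet_forestFamily H (Finset.erase_subset _ _) hF, hnotC _ h1⟩, h1⟩

end Partial

/-! ### Degrees, components and connected subgraphs -/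

section Subgraphs

variable {V : Type*} {T : SimpleGraph V}

theorem deg_eq_one_iff {H : T.Subgraph} {x : V} :
    deg H x = 1 ↔ ∃ y, H.Adj x y ∧ ∀ z, H.Adj x z → z = y := by
  rw [deg, Set.ncard_eq_one]
  refine exists_congr fun y => ⟨fun h => ?_, fun h => ?_⟩
  · have h' : ∀ z, H.Adj x z ↔ z = y := fun z => by
      rw [← SimpleGraph.Subgraph.mem_neighborSet, h, Set.mem_singleton_iff]
    exact ⟨(h' y).2 rfl, fun z => (h' z).1⟩
  · ext z
    rw [SimpleGraph.Subgraph.mem_neighborSet, Set.mem_singleton_iff]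
    exact ⟨h.2 z, fun e => e ▸ h.1⟩

theorem eq_of_deg_eq_one {H : T.Subgraph} {x y z : V} (h : deg H x = 1) (hy : H.Adj x y)
    (hz : H.Adj x z) : y = z := by
  obtain ⟨u, -, hu⟩ := deg_eq_one_iff.1 h
  rw [hu y hy, hu z hz]

theorem deg_ne_one {H : T.Subgraph} {x y z : V} (hy : H.Adj x y) (hz : H.Adj x z)
    (hne : y ≠ z) : deg H x ≠ 1 := fun h => hne (eq_of_deg_eq_one h hy hz)

theorem deg_congr {H H' : T.Subgraph} {x : V} (h : ∀ y, H.Adj x y ↔ H'.Adj x y) :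
    deg H x = deg H' x :=
  congrArg Set.ncard (Set.ext h)

theorem adj_of_deg_eq [Finite V] {B H : T.Subgraph} (h : B ≤ H) {x y : V}
    (hd : deg B x = deg H x) (hxy : H.Adj x y) : B.Adj x y := by
  have : B.neighborSet x = H.neighborSet x :=
    Set.eq_of_subset_of_ncard_le (fun z hz => h.2 hz) hd.ge (Set.toFinite _)
  have h' : y ∈ H.neighborSet x := hxy
  rwa [← this] at h'

theorem isLeaf_coe_iff {B : T.Subgraph} (x : B.verts) : IsLeaf B.coe x ↔ deg B x = 1 := by
  have : ((↑) : B.verts → V) '' (B.coe.neighborSet x) = B.neighborSet x := by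
    ext y
    simp only [Set.mem_image, SimpleGraph.mem_neighborSet, SimpleGraph.Subgraph.coe_adj,
      SimpleGraph.Subgraph.mem_neighborSet, Subtype.exists, exists_and_left, exists_prop,
      exists_eq_right_right]
    exact ⟨fun h => h.1, fun h => ⟨h, B.edge_vert h.symm⟩⟩
  rw [IsLeaf, deg, ← this, Set.ncard_image_of_injective _ Subtype.val_injective]

variable {H : T.Subgraph} {v : V}

theorem component_adj_iff {x : V} (hx : x ∈ (component H v).verts) (y : V) :
    (component H v).Adj x y ↔ H.Adj x y := by
  refine ⟨fun h => h.2.2, fun h => ⟨hx, ?_, h⟩⟩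
  have hx' : H.spanningCoe.Reachable v x := hx
  exact hx'.trans (SimpleGraph.Adj.reachable (by simpa using h))

theorem deg_component {x : V} (hx : x ∈ (component H v).verts) :
    deg (component H v) x = deg H x :=
  deg_congr (component_adj_iff hx)

theorem component_le (hv : v ∈ H.verts) : component H v ≤ H := by
  refine ⟨fun x hx => ?_, fun x y h => h.2.2⟩
  have hx' : H.spanningCoe.Reachable v x := hx
  rw [SimpleGraph.reachable_iff_reflTransGen] at hx'
  rcases Relation.ReflTransGen.cases_tail hx' with rfl | ⟨y, -, hy⟩
  · exact hv
  · exact H.edge_vert (show H.Adj y x from hy).symm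

theorem le_component {B : T.Subgraph} (hB : B ≤ H) (hc : B.coe.Preconnected)
    (hv : v ∈ B.verts) : B ≤ component H v := by
  have hreach : ∀ x ∈ B.verts, H.spanningCoe.Reachable v x := by
    intro x hx
    let f : B.coe →g H.spanningCoe :=
      ⟨fun z => z, fun {_ _} h => hB.2 h⟩
    exact (hc ⟨v, hv⟩ ⟨x, hx⟩).map f
  exact ⟨hreach, fun x y h => ⟨hreach x (B.edge_vert h), hreach y (B.edge_vert h.symm), hB.2 h⟩⟩

/-- All edges from `x` towards the root belong to `B`. -/
inductive Attached (R : Rooting T v) (B : T.Subgraph) : V → Prop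
  | root : Attached R B v
  | step (x : V) (hx : x ≠ v) (h : B.Adj x (R.par x)) (h' : Attached R B (R.par x)) :
      Attached R B x

/-- Along a walk in `B` that starts at the root, `Attached` persists: a step down adds one edge of
`B`, and a step up returns to a vertex already known to be attached. -/
theorem adj_par (R : Rooting T v) {B : T.Subgraph} (hc : B.coe.Preconnected) (hv : v ∈ B.verts)
    {x : V} (hx : x ∈ B.verts) (hxv : x ≠ v) : B.Adj x (R.par x) := by
  have key : ∀ y : B.verts, Relation.ReflTransGen B.coe.Adj ⟨v, hv⟩ y → Attached R B y := by
    intro y hy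
    induction hy with
    | refl => exact .root
    | @tail y z _ h ih =>
      have h' : B.Adj y z := h
      rcases R.cases _ _ h'.adj_sub with ⟨hy, e⟩ | ⟨hz, e⟩
      · cases ih with
        | root => exact absurd rfl hy
        | step _ _ _ h2 => rwa [e] at h2
      · exact .step _ hz (e.symm ▸ h'.symm) (e.symm ▸ ih)
  cases key ⟨x, hx⟩ ((SimpleGraph.reachable_iff_reflTransGen _ _).1 (hc _ _)) with
  | root => exact absurd rfl hxv
  | step _ _ h _ => exact h

/-- The number of directed edges of a subgraph. -/
noncomputable def numDarts (H : T.Subgraph) : ℕ :=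
  {e : V × V | H.Adj e.1 e.2}.ncard

theorem numDarts_add_two [Finite V] (R : Rooting T v) {B : T.Subgraph}
    (hc : B.coe.Preconnected) (hv : v ∈ B.verts) : numDarts B + 2 = 2 * B.verts.ncard := by
  have hpar : ∀ x ∈ B.verts \ {v}, B.Adj x (R.par x) := fun x hx => adj_par R hc hv hx.1 hx.2
  have e : {e : V × V | B.Adj e.1 e.2} = (fun x => (x, R.par x)) '' (B.verts \ {v}) ∪
      (fun x => (R.par x, x)) '' (B.verts \ {v}) := by
    ext ⟨a, b⟩
    simp only [Set.mem_ofPred_eq, Set.mem_union, Set.mem_image, Prod.mk.injEq]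
    constructor
    · intro h
      rcases R.cases _ _ h.adj_sub with ⟨h1, h2⟩ | ⟨h1, h2⟩
      · exact .inl ⟨a, ⟨B.edge_vert h, h1⟩, rfl, h2⟩
      · exact .inr ⟨b, ⟨B.edge_vert h.symm, h1⟩, h2, rfl⟩
    · rintro (⟨x, hx, rfl, rfl⟩ | ⟨x, hx, rfl, rfl⟩)
      · exact hpar x hx
      · exact (hpar x hx).symm
  have hdisj : Disjoint ((fun x => (x, R.par x)) '' (B.verts \ {v}))
      ((fun x => (R.par x, x)) '' (B.verts \ {v})) := by
    rw [Set.disjoint_left]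
    rintro _ ⟨x, hx, rfl⟩ ⟨y, hy, h⟩
    simp only [Prod.mk.injEq] at h
    have h1 := R.ht_par x hx.2
    have h2 := R.ht_par y hy.2
    rw [h.1] at h2
    rw [← h.2] at h1
    omega
  rw [numDarts, e, Set.ncard_union_eq hdisj (Set.toFinite _) (Set.toFinite _),
    Set.ncard_image_of_injective _ (fun x y h => congrArg Prod.fst h),
    Set.ncard_image_of_injective _ (fun x y h => congrArg Prod.snd h)]
  have := Set.ncard_sdiff_singleton_add_one hv (Set.toFinite _)
  omega

end Subgraphs

/-! ### Admissible basic trees and complete choices -/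

section Admissible

variable {V : Type*} {T : SimpleGraph V}

/-- The subgraph of `H` formed by the edges that meet a head of an edge in `S`. -/
def spanned (H : T.Subgraph) (S : Finset (V × V)) : T.Subgraph where
  verts := {x | ∃ y, H.Adj x y ∧ (Head S x ∨ Head S y)}
  Adj x y := H.Adj x y ∧ (Head S x ∨ Head S y)
  adj_sub h := h.1.adj_sub
  edge_vert h := ⟨_, h⟩
  symm := ⟨fun _ _ h => ⟨h.1.symm, h.2.symm⟩⟩

theorem spanned_le (H : T.Subgraph) (S : Finset (V × V)) : spanned H S ≤ H :=
  ⟨fun _ ⟨_, h, _⟩ => H.edge_vert h, fun _ _ h => h.1⟩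

variable {v w : V} {R : Rooting T v} {H : T.Subgraph} {S : Finset (V × V)}

/-- A neighbour of a head is a head or the chosen leaf there: a child that is neither would be
pending, and the parent is a head by `up`, except at `w`, whose parent `v` is the chosen leaf. -/
theorem IsComplete.head_or_mem (hS : IsComplete R H w S) {a b : V} (h : H.Adj a b)
    (hb : Head S b) : Head S a ∨ (a, b) ∈ S := by
  by_cases hab : (a, b) ∈ S
  · exact .inr hab
  left
  rcases R.cases _ _ h.adj_sub with ⟨ha, rfl⟩ | ⟨hbv, rfl⟩
  · by_contra hn
    exact hS.not_pending a ⟨ha, hb, hab, h, hn⟩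
  · by_cases hbw : b = w
    · subst hbw
      rw [hS.par_base.2] at hab
      exact absurd hS.base hab
    · exact (hS.up b hb hbw).1

theorem IsComplete.mem_verts_iff (hS : IsComplete R H w S) {x : V} :
    x ∈ (spanned H S).verts ↔ Head S x ∨ ∃ y, (x, y) ∈ S := by
  constructor
  · rintro ⟨y, h, hx | hy⟩
    · exact .inl hx
    · exact (hS.head_or_mem h hy).imp id fun h => ⟨y, h⟩
  · rintro (⟨y, h⟩ | ⟨y, h⟩)
    · exact ⟨y, (hS.adj _ _ h).symm, .inl ⟨y, h⟩⟩
    · exact ⟨y, hS.adj _ _ h, .inr ⟨x, h⟩⟩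

theorem IsComplete.spanned_adj_of_mem (hS : IsComplete R H w S) {x y : V} (h : (x, y) ∈ S) :
    (spanned H S).Adj x y := ⟨hS.adj _ _ h, .inr ⟨x, h⟩⟩

theorem IsComplete.eq_of_mem (hS : IsComplete R H w S) {x y z : V} (h : (x, y) ∈ S)
    (hz : (spanned H S).Adj x z) : z = y := by
  have hz' : Head S z := hz.2.resolve_left (hS.not_head_of_mem h)
  have := (hS.head_or_mem hz.1 hz').resolve_left (hS.not_head_of_mem h)
  exact hS.eq_of_mem_of_mem this h

theorem IsComplete.deg_of_mem (hS : IsComplete R H w S) {x y : V} (h : (x, y) ∈ S) :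
    deg (spanned H S) x = 1 :=
  deg_eq_one_iff.2 ⟨y, hS.spanned_adj_of_mem h, fun _ => hS.eq_of_mem h⟩

theorem deg_spanned_of_head {x : V} (h : Head S x) : deg (spanned H S) x = deg H x :=
  deg_congr fun _ => ⟨fun h => h.1, fun hy => ⟨hy, .inl h⟩⟩

theorem IsComplete.deg_ne_one_of_head (hS : IsComplete R H w S) {x : V} (h : Head S x)
    (hx : x ≠ w) : deg (spanned H S) x ≠ 1 := by
  rw [deg_spanned_of_head h]
  obtain ⟨y, hy⟩ := h
  have hup := hS.up x ⟨y, hy⟩ hx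
  refine deg_ne_one (hS.adj _ _ hy).symm hup.2.2 ?_
  rintro rfl
  exact hS.not_head_of_mem hy hup.1

theorem IsComplete.root_mem (hS : IsComplete R H w S) : v ∈ (spanned H S).verts :=
  hS.mem_verts_iff.2 (.inr ⟨w, hS.base⟩)

theorem IsComplete.preconnected (hS : IsComplete R H w S) :
    (spanned H S).coe.Preconnected := by
  have hadj : ∀ {x y : V} (h : (spanned H S).Adj x y), (spanned H S).coe.Reachable
      ⟨x, (spanned H S).edge_vert h⟩ ⟨y, (spanned H S).edge_vert h.symm⟩ :=
    fun h => SimpleGraph.Adj.reachable h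
  have hhead : ∀ x (hx : x ∈ (spanned H S).verts), Head S x →
      (spanned H S).coe.Reachable ⟨v, hS.root_mem⟩ ⟨x, hx⟩ := by
    intro x hx h
    induction hn : R.ht x using Nat.strong_induction_on generalizing x with
    | _ n ih =>
      subst hn
      by_cases hxw : x = w
      · subst hxw
        exact hadj (hS.spanned_adj_of_mem hS.base)
      · have hup := hS.up x h hxw
        have ha : (spanned H S).Adj (R.par x) x := ⟨hup.2.2.symm, .inl hup.1⟩
        exact (ih _ (R.ht_par x (hS.head_ne x h)) _ _ hup.1 rfl).trans (hadj ha)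
  have hall : ∀ x : (spanned H S).verts,
      (spanned H S).coe.Reachable ⟨v, hS.root_mem⟩ x := by
    rintro ⟨x, hx⟩
    rcases hS.mem_verts_iff.1 hx with h | ⟨y, hy⟩
    · exact hhead x hx h
    · have ha := hS.spanned_adj_of_mem hy
      exact (hhead y ((spanned H S).edge_vert ha.symm) ⟨x, hy⟩).trans (hadj ha.symm)
  exact fun x y => (hall x).symm.trans (hall y)

theorem IsComplete.ncard_heads [Finite V] (hS : IsComplete R H w S) :
    {x | Head S x}.ncard = S.card := by
  have : {x | Head S x} = Prod.snd '' (S : Set (V × V)) := by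
    ext x
    simp [Head]
  rw [this, Set.InjOn.ncard_image, Set.ncard_coe_finset]
  rintro ⟨a, c⟩ ha ⟨b, c'⟩ hb rfl
  rw [hS.inj _ _ _ ha hb]

theorem IsComplete.ncard_tails [Finite V] (hS : IsComplete R H w S) :
    {x | ∃ y, (x, y) ∈ S}.ncard = S.card := by
  have : {x | ∃ y, (x, y) ∈ S} = Prod.fst '' (S : Set (V × V)) := by
    ext x
    simp
  rw [this, Set.InjOn.ncard_image, Set.ncard_coe_finset]
  rintro ⟨a, c⟩ ha ⟨b, c'⟩ hb rfl
  rw [hS.eq_of_mem_of_mem ha hb]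

theorem IsComplete.ncard_verts [Finite V] (hS : IsComplete R H w S) :
    (spanned H S).verts.ncard = 2 * S.card := by
  have : (spanned H S).verts = {x | Head S x} ∪ {x | ∃ y, (x, y) ∈ S} :=
    Set.ext fun x => hS.mem_verts_iff
  rw [this, Set.ncard_union_eq ?_ (Set.toFinite _) (Set.toFinite _), hS.ncard_heads,
    hS.ncard_tails, two_mul]
  rw [Set.disjoint_left]
  rintro x hx ⟨y, hy⟩
  exact hS.not_head_of_mem hy hx

theorem IsFirstLeaf.exists_adj [LinearOrder V] (hv : IsFirstLeaf H v) :
    ∃ w, H.Adj v w ∧ ∀ y, H.Adj v y → y = w :=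
  deg_eq_one_iff.1 hv.1.2

theorem component_verts_of_deg {w : V} (hvw : H.Adj v w) (hleaf : ∀ y, H.Adj v y → y = w)
    (hw : deg H w = 1) : (component H v).verts = {v, w} := by
  ext x
  constructor
  · intro hx
    have hx' : H.spanningCoe.Reachable v x := hx
    rw [SimpleGraph.reachable_iff_reflTransGen] at hx'
    induction hx' with
    | refl => simp
    | @tail y z hy h ih =>
      have h : H.Adj y z := h
      rcases ih ((SimpleGraph.reachable_iff_reflTransGen _ _).2 hy) with rfl | rfl
      · rw [hleaf z h]; simp
      · rw [eq_of_deg_eq_one hw h hvw.symm]; simp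
  · rintro (rfl | rfl)
    · exact SimpleGraph.Reachable.refl _
    · exact SimpleGraph.Adj.reachable (by simpa using hvw)

/-- `S` matches its tails with its heads. Tails are leaves; a head other than `w` is adjacent to its
tail and to its parent, so it is not a leaf, and heads keep all their edges. Only `w` can be a leaf,
and then the component is the single edge `vw`. -/
theorem IsComplete.isAdmissible [Finite V] (hT : T.IsAcyclic) (hS : IsComplete R H w S)
    (hleaf : ∀ y, H.Adj v y → y = w) :
    IsAdmissible (component H v) v (spanned H S) := by
  have hle : spanned H S ≤ component H v :=
    le_component (spanned_le H S) hS.preconnected hS.root_mem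
  have hvw := hS.adj _ _ hS.base
  have htree : (spanned H S).coe.IsTree :=
    ⟨{ preconnected := hS.preconnected, nonempty := ⟨⟨v, hS.root_mem⟩⟩ }, hT.subgraph _⟩
  have hcard : Nat.card (spanned H S).verts = 2 * S.card := by
    rw [Nat.card_coe_set_eq, hS.ncard_verts]
  have hdeg : ∀ x ∈ (spanned H S).verts, deg (spanned H S) x ≠ 1 →
      deg (spanned H S) x = deg (component H v) x := by
    intro x hx hd
    rw [deg_component (hle.1 hx)]
    rcases hS.mem_verts_iff.1 hx with h | ⟨y, hy⟩
    · exact deg_spanned_of_head h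
    · exact absurd (hS.deg_of_mem hy) hd
  have hwB : w ∈ (spanned H S).verts := hS.mem_verts_iff.2 (.inl ⟨v, hS.base⟩)
  have hne : v ≠ w := hvw.ne
  by_cases hw : deg H w = 1
  · have hcomp := component_verts_of_deg hvw hleaf hw
    have hB : (spanned H S).verts = {v, w} := by
      refine (hle.1.trans hcomp.subset).antisymm ?_
      rintro _ (rfl | rfl)
      · exact hS.root_mem
      · exact hwB
    refine ⟨hle, ⟨htree, .inl ?_⟩, hS.root_mem, hdeg, ?_⟩
    · rw [Nat.card_coe_set_eq, hB, Set.ncard_pair hne]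
    · rw [hcomp, Set.ncard_pair hne]
      omega
  · have hhead : ∀ x, Head S x → deg (spanned H S) x ≠ 1 := by
      intro x hx
      by_cases hxw : x = w
      · subst hxw
        rwa [deg_spanned_of_head hx]
      · exact hS.deg_ne_one_of_head hx hxw
    have hleaf_iff : ∀ x : (spanned H S).verts,
        IsLeaf (spanned H S).coe x ↔ ∃ y, ((x : V), y) ∈ S := by
      intro x
      rw [isLeaf_coe_iff]
      refine ⟨fun hd => ?_, fun ⟨y, hy⟩ => hS.deg_of_mem hy⟩
      exact (hS.mem_verts_iff.1 x.2).resolve_left fun h => hhead _ h hd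
    have hhead_iff : ∀ x : (spanned H S).verts,
        ¬ IsLeaf (spanned H S).coe x ↔ Head S x := by
      intro x
      rw [hleaf_iff]
      refine ⟨fun h => (hS.mem_verts_iff.1 x.2).resolve_right h, ?_⟩
      rintro h ⟨y, hy⟩
      exact hS.not_head_of_mem hy h
    refine ⟨hle, ⟨htree, .inr ⟨⟨S.card, hcard, ?_, ?_⟩, ?_⟩⟩, hS.root_mem, hdeg, fun _ => ?_⟩
    · rw [← hS.ncard_tails, ← Set.ncard_image_of_injective _ Subtype.val_injective]
      congr 1
      ext x
      simp only [hleaf_iff, Set.mem_image, Set.mem_ofPred_eq, Subtype.exists, exists_and_left,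
        exists_prop, exists_eq_right_right, and_iff_left_iff_imp]
      exact fun h => hS.mem_verts_iff.2 (.inr h)
    · rw [← hS.ncard_heads, ← Set.ncard_image_of_injective _ Subtype.val_injective]
      congr 1
      ext x
      simp only [hhead_iff, Set.mem_image, Set.mem_ofPred_eq, Subtype.exists, exists_and_left,
        exists_prop, exists_eq_right_right, and_iff_left_iff_imp]
      exact fun h => hS.mem_verts_iff.2 (.inl h)
    · intro x hx
      obtain ⟨y, hy⟩ := (hhead_iff x).1 hx
      refine ⟨⟨y, hS.mem_verts_iff.2 (.inr ⟨_, hy⟩)⟩,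
        ⟨(hleaf_iff _).2 ⟨_, hy⟩, (hS.spanned_adj_of_mem hy).symm⟩, ?_⟩
      rintro ⟨y', hy'⟩ ⟨h1, h2⟩
      obtain ⟨x', hx'⟩ := (hleaf_iff _).1 h1
      have h2 : (spanned H S).Adj x y' := h2
      obtain rfl : (x : V) = x' := hS.eq_of_mem hx' h2.symm
      exact Subtype.ext (hS.inj _ _ _ hx' hy)
    · by_contra hlt
      have hsub : ({v, w} : Set V) ⊆ (spanned H S).verts := by
        rintro _ (rfl | rfl)
        · exact hS.root_mem
        · exact hwB
      have heq := Set.eq_of_subset_of_ncard_le hsub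
        (by rw [Set.ncard_pair hne]; omega) (Set.toFinite _)
      refine hw (deg_eq_one_iff.2 ⟨v, hvw.symm, fun z hz => ?_⟩)
      have ha : (spanned H S).Adj w z := ⟨hz, .inl ⟨v, hS.base⟩⟩
      have hz' := (spanned H S).edge_vert ha.symm
      rw [← heq] at hz'
      rcases hz' with rfl | rfl
      · rfl
      · exact absurd hz (H.loopless.irrefl _)

open Classical in
/-- The edges of a basic tree that lead from a leaf to its neighbour. If the tree has only two
vertices, then the edge that starts at the smaller vertex is taken. -/
noncomputable def leafDarts [Fintype V] [LinearOrder V] (B : T.Subgraph) : Finset (V × V) :=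
  Finset.univ.filter fun e => B.Adj e.1 e.2 ∧ deg B e.1 = 1 ∧ (deg B e.2 = 1 → e.1 < e.2)

variable [Fintype V] [LinearOrder V]

theorem mem_leafDarts {B : T.Subgraph} {y x : V} :
    (y, x) ∈ leafDarts B ↔ B.Adj y x ∧ deg B y = 1 ∧ (deg B x = 1 → y < x) := by
  simp [leafDarts]

/-- Recovers the choice from the tree alone. In a tree with two vertices both orientations would
qualify; since `v` is the first leaf, the order selects `(v, w)`. -/
theorem IsComplete.leafDarts_spanned (hS : IsComplete R H w S) (hv : IsFirstLeaf H v) :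
    leafDarts (spanned H S) = S := by
  have hmin : deg (spanned H S) w = 1 → v < w := by
    intro h
    have hw : Head S w := ⟨v, hS.base⟩
    rw [deg_spanned_of_head hw] at h
    have hvw := hS.adj _ _ hS.base
    exact lt_of_le_of_ne (hv.2 ⟨H.edge_vert hvw.symm, h⟩) (hvw.ne)
  ext ⟨y, x⟩
  rw [mem_leafDarts]
  constructor
  · rintro ⟨h1, h2, h3⟩
    rcases hS.mem_verts_iff.1 ((spanned H S).edge_vert h1) with hy | ⟨x', hx'⟩
    · have hyw : y = w := by
        by_contra hyw
        exact hS.deg_ne_one_of_head hy hyw h2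
      subst hyw
      have hxv : x = v :=
        eq_of_deg_eq_one h2 h1 (hS.spanned_adj_of_mem hS.base).symm
      subst hxv
      exact absurd (h3 (hS.deg_of_mem hS.base)) (hmin h2).le.not_gt
    · rwa [hS.eq_of_mem hx' h1]
  · intro h
    refine ⟨hS.spanned_adj_of_mem h, hS.deg_of_mem h, fun hx => ?_⟩
    have hxw : x = w := by
      by_contra hxw
      exact hS.deg_ne_one_of_head ⟨y, h⟩ hxw hx
    subst hxw
    rw [hS.inj _ _ _ h hS.base]
    exact hmin hx

end Admissible

/-! ### From admissible basic trees to complete choices. -/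

section Decomposition

variable {V : Type*} {T : SimpleGraph V} {v w : V} {R : Rooting T v} {H : T.Subgraph}
  {S : Finset (V × V)}

theorem spanned_eq {B : T.Subgraph} (hadj : ∀ a b, B.Adj a b ↔ (spanned H S).Adj a b)
    (hB : ∀ x ∈ B.verts, ∃ y, B.Adj x y) : spanned H S = B := by
  refine SimpleGraph.Subgraph.ext (Set.ext fun x => ?_) ?_
  · constructor
    · rintro ⟨y, hy⟩
      exact B.edge_vert ((hadj x y).2 hy)
    · intro hx
      obtain ⟨y, hy⟩ := hB x hx
      exact ⟨y, (hadj x y).1 hy⟩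
  · ext a b
    exact (hadj a b).symm

theorem head_singleton {x : V} : Head {(v, w)} x ↔ x = w := by
  simp [Head]

/-- Inverse to `IsComplete.isAdmissible`. If `B` has more than two vertices, no two of its leaves
are adjacent, so the heads of `leafDarts B` are exactly its non-leaves, and uniqueness of their leaf
neighbours gives `inj`. Full degree at non-leaves rules out pending vertices. -/
theorem IsAdmissible.isComplete [Fintype V] [LinearOrder V] (R : Rooting T v)
    (hv : IsFirstLeaf H v) (hvw : H.Adj v w) (hleaf : ∀ y, H.Adj v y → y = w) {B : T.Subgraph}
    (hB : IsAdmissible (component H v) v B) :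
    IsComplete R H w (leafDarts B) ∧ spanned H (leafDarts B) = B := by
  have hBH : B ≤ H := hB.le.trans (component_le hv.1.1)
  have hc : B.coe.Preconnected := hB.isBasicTree.1.connected.preconnected
  have hcard : Nat.card B.verts = B.verts.ncard := Nat.card_coe_set_eq _
  have hne0 : B.verts.ncard ≠ 0 := Set.ncard_ne_zero_of_mem hB.mem (Set.toFinite _)
  have htwo : 2 ≤ B.verts.ncard := by
    rcases hB.isBasicTree.2 with h | ⟨⟨k, h, -⟩, -⟩ <;> omega
  have hvB : B.Adj v w := by
    obtain ⟨x, hx, hxv⟩ := Set.exists_ne_of_one_lt_ncard (s := B.verts) (by omega) v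
    have hr := (SimpleGraph.reachable_iff_reflTransGen _ _).1 (hc ⟨v, hB.mem⟩ ⟨x, hx⟩)
    rcases Relation.ReflTransGen.cases_head hr with h | ⟨y, hy, -⟩
    · exact absurd (congrArg Subtype.val h).symm hxv
    · have hy : B.Adj v y := hy
      rwa [hleaf y (hBH.2 hy)] at hy
  have hnbr : ∀ x ∈ B.verts, ∃ y, B.Adj x y := by
    intro x hx
    by_cases hxv : x = v
    · exact ⟨w, hxv ▸ hvB⟩
    · exact ⟨_, adj_par R hc hB.mem hx hxv⟩
  have hdv : deg B v = 1 := deg_eq_one_iff.2 ⟨w, hvB, fun z hz => hleaf z (hBH.2 hz)⟩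
  have hwv : R.par w = v := (R.par_eq hvw.adj_sub).2
  by_cases h2 : B.verts.ncard = 2
  -- A tree with two vertices is admissible only if it is the whole component, by `two_lt`.
  · have hC : (component H v).verts = B.verts := by
      refine (Set.eq_of_subset_of_ncard_le hB.le.1 ?_ (Set.toFinite _)).symm
      have := hB.two_lt
      omega
    have hBv : B.verts = {v, w} := by
      refine (Set.eq_of_subset_of_ncard_le ?_ ?_ (Set.toFinite _)).symm
      · rintro _ (rfl | rfl)
        · exact hB.mem
        · exact B.edge_vert hvB.symm
      · rw [h2, Set.ncard_pair hvw.ne]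
    have hwC : w ∈ (component H v).verts := hC ▸ B.edge_vert hvB.symm
    have hwH : ∀ z, H.Adj w z → z = v := by
      intro z hz
      have hz' := (component H v).edge_vert ((component_adj_iff hwC z).2 hz).symm
      rw [hC, hBv] at hz'
      rcases hz' with rfl | rfl
      · rfl
      · exact absurd hz (H.loopless.irrefl _)
    have hdw : deg B w = 1 := deg_eq_one_iff.2 ⟨v, hvB.symm, fun z hz => hwH z (hBH.2 hz)⟩
    have hlt : v < w := lt_of_le_of_ne
      (hv.2 ⟨H.edge_vert hvw.symm, deg_eq_one_iff.2 ⟨v, hvw.symm, hwH⟩⟩) hvw.ne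
    have hBadj : ∀ a b, B.Adj a b ↔ a = v ∧ b = w ∨ a = w ∧ b = v := by
      intro a b
      constructor
      · intro h
        have ha := B.edge_vert h
        rw [hBv] at ha
        rcases ha with rfl | rfl
        · exact .inl ⟨rfl, hleaf b (hBH.2 h)⟩
        · exact .inr ⟨rfl, hwH b (hBH.2 h)⟩
      · rintro (⟨rfl, rfl⟩ | ⟨rfl, rfl⟩)
        · exact hvB
        · exact hvB.symm
    have hS : leafDarts B = {(v, w)} := by
      ext ⟨y, x⟩
      rw [mem_leafDarts, hBadj, Finset.mem_singleton, Prod.mk.injEq]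
      constructor
      · rintro ⟨h' | ⟨rfl, rfl⟩, -, h⟩
        · exact h'
        · exact absurd (h hdv) hlt.not_gt
      · rintro ⟨rfl, rfl⟩
        exact ⟨.inl ⟨rfl, rfl⟩, hdv, fun _ => hlt⟩
    rw [hS]
    refine ⟨⟨IsPartial.singleton R hvw, fun x hx => ?_⟩, spanned_eq (fun a b => ?_) hnbr⟩
    · have h1 := head_singleton.1 hx.head
      exact hx.ne (hwH x (h1 ▸ hx.adj.symm))
    · rw [hBadj]
      constructor
      · rintro (⟨rfl, rfl⟩ | ⟨rfl, rfl⟩)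
        · exact ⟨hvw, .inr (head_singleton.2 rfl)⟩
        · exact ⟨hvw.symm, .inl (head_singleton.2 rfl)⟩
      · rintro ⟨h, h' | h'⟩
        · obtain rfl := head_singleton.1 h'
          exact .inr ⟨rfl, hwH b h⟩
        · obtain rfl := head_singleton.1 h'
          exact .inl ⟨hwH a h.symm, rfl⟩
  · have hex : ∀ x ∈ B.verts, deg B x ≠ 1 →
        ∃ y, (deg B y = 1 ∧ B.Adj x y) ∧ ∀ z, deg B z = 1 → B.Adj x z → z = y := by
      intro x hx hd
      have h := (hB.isBasicTree.2.resolve_left (by rwa [hcard])).2 ⟨x, hx⟩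
        (by rwa [isLeaf_coe_iff])
      obtain ⟨y, ⟨h1, h1'⟩, h3⟩ := h
      refine ⟨y, ⟨(isLeaf_coe_iff y).1 h1, h1'⟩, fun z hz hxz => ?_⟩
      exact congrArg Subtype.val
        (h3 ⟨z, B.edge_vert hxz.symm⟩ ⟨(isLeaf_coe_iff _).2 hz, hxz⟩)
    have hleafleaf : ∀ x y, B.Adj x y → deg B x = 1 → deg B y ≠ 1 := by
      intro x y hxy hx hy
      have hsub : B.verts ⊆ {x, y} := by
        intro z hz
        have hr := (SimpleGraph.reachable_iff_reflTransGen _ _).1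
          (hc ⟨x, B.edge_vert hxy⟩ ⟨z, hz⟩)
        have : ∀ z : B.verts, Relation.ReflTransGen B.coe.Adj ⟨x, B.edge_vert hxy⟩ z →
            (z : V) ∈ ({x, y} : Set V) := by
          intro z hz
          induction hz with
          | refl => simp
          | @tail a b _ h ih =>
            have h : B.Adj a b := h
            rcases ih with e | e
            · rw [e] at h
              rw [eq_of_deg_eq_one hx h hxy]; simp
            · rw [Set.mem_singleton_iff.1 e] at h
              rw [eq_of_deg_eq_one hy h hxy.symm]; simp
        exact this _ hr
      have := Set.ncard_le_ncard hsub (Set.toFinite _)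
      have := Set.ncard_pair hxy.ne
      omega
    have hmem : ∀ y x, (y, x) ∈ leafDarts B ↔ B.Adj y x ∧ deg B y = 1 := by
      intro y x
      rw [mem_leafDarts]
      exact ⟨fun h => ⟨h.1, h.2.1⟩,
        fun h => ⟨h.1, h.2, fun hx => absurd hx (hleafleaf _ _ h.1 h.2)⟩⟩
    have hhead : ∀ x, Head (leafDarts B) x ↔ x ∈ B.verts ∧ deg B x ≠ 1 := by
      intro x
      constructor
      · rintro ⟨y, hy⟩
        rw [hmem] at hy
        exact ⟨B.edge_vert hy.1.symm, hleafleaf _ _ hy.1 hy.2⟩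
      · rintro ⟨hx, hd⟩
        obtain ⟨y, ⟨h1, h2⟩, -⟩ := hex x hx hd
        exact ⟨y, (hmem _ _).2 ⟨h2.symm, h1⟩⟩
    have hfull : ∀ x, Head (leafDarts B) x → ∀ y, H.Adj x y → B.Adj x y := by
      intro x hx y hxy
      rw [hhead] at hx
      refine adj_of_deg_eq hB.le (hB.deg_eq x hx.1 hx.2) ?_
      exact (component_adj_iff (hB.le.1 hx.1) y).2 hxy
    refine ⟨⟨⟨?_, ?_, ?_, ?_, ?_, ?_⟩, fun x hx => ?_⟩, spanned_eq (fun a b => ?_) hnbr⟩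
    · exact (hmem _ _).2 ⟨hvB, hdv⟩
    · exact fun y x h => hBH.2 ((hmem _ _).1 h).1
    · intro y x h
      rw [hmem] at h
      by_cases hy : y = v
      · subst hy
        exact .inl ⟨rfl, hleaf x (hBH.2 h.1)⟩
      · exact .inr ⟨hy, eq_of_deg_eq_one h.2 (adj_par R hc hB.mem (B.edge_vert h.1) hy) h.1⟩
    · intro a b c ha hb
      have hcc := (hhead c).1 ⟨a, ha⟩
      rw [hmem] at ha hb
      obtain ⟨y, -, hy⟩ := hex c hcc.1 hcc.2
      rw [hy a ha.2 ha.1.symm, hy b hb.2 hb.1.symm]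
    · rintro x hx rfl
      exact ((hhead x).1 hx).2 hdv
    · intro x hx hxw
      rw [hhead] at hx
      have hxv : x ≠ v := by
        rintro rfl
        exact hx.2 hdv
      have hxp := adj_par R hc hB.mem hx.1 hxv
      have hpv : R.par x ≠ v := by
        intro h
        rw [h] at hxp
        exact hxw (hleaf x (hBH.2 hxp.symm))
      have hpp := adj_par R hc hB.mem (B.edge_vert hxp.symm) hpv
      refine ⟨(hhead _).2 ⟨B.edge_vert hxp.symm, ?_⟩, fun h => hx.2 ((hmem _ _).1 h).2,
        hBH.2 hxp⟩
      exact deg_ne_one hpp hxp.symm (R.par_par_ne hxv hpv)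
    · have hxp := (hfull _ hx.head x hx.adj.symm).symm
      by_cases hd : deg B x = 1
      · exact hx.notMem ((hmem _ _).2 ⟨hxp, hd⟩)
      · exact hx.not_head ((hhead x).2 ⟨B.edge_vert hxp, hd⟩)
    · constructor
      · intro h
        refine ⟨hBH.2 h, ?_⟩
        rw [hhead, hhead]
        by_cases hd : deg B a = 1
        · exact .inr ⟨B.edge_vert h.symm, hleafleaf _ _ h hd⟩
        · exact .inl ⟨B.edge_vert h, hd⟩
      · rintro ⟨h, h' | h'⟩
        · exact hfull a h' b h
        · exact (hfull b h' a h.symm).symm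

/-! ### Removing a basic tree -/

/-- Every vertex of `H` has a neighbour. -/
def NoIsolated (H : T.Subgraph) : Prop :=
  ∀ x ∈ H.verts, ∃ y, H.Adj x y

/-- Besides the heads, `remove` deletes only vertices all of whose edges in `H` go to heads, so
exactly the edges that meet a head disappear. -/
theorem IsComplete.remove_adj_iff (hS : IsComplete R H w S) {a b : V} :
    (remove H (spanned H S)).Adj a b ↔ H.Adj a b ∧ ¬ Head S a ∧ ¬ Head S b := by
  have hdel : ∀ x, Head S x →
      x ∈ (spanned H S).verts ∧ deg (spanned H S) x = deg H x := fun x hx =>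
    ⟨hS.mem_verts_iff.2 (.inl hx), deg_spanned_of_head hx⟩
  have hkeep : ∀ x y, H.Adj x y → ¬ Head S x → ¬ Head S y →
      ¬ (x ∈ (spanned H S).verts ∧ deg (spanned H S) x = deg H x) := by
    rintro x y hxy hx hy ⟨hm, hd⟩
    obtain ⟨z, hz⟩ := (hS.mem_verts_iff.1 hm).resolve_left hx
    rw [hS.deg_of_mem hz] at hd
    rw [eq_of_deg_eq_one hd.symm hxy (hS.adj _ _ hz)] at hy
    exact hy ⟨x, hz⟩
  rw [remove, SimpleGraph.Subgraph.deleteVerts_adj]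
  constructor
  · rintro ⟨-, ha, -, hb, h⟩
    exact ⟨h, fun h => ha (hdel a h), fun h => hb (hdel b h)⟩
  · rintro ⟨h, ha, hb⟩
    exact ⟨H.edge_vert h, hkeep a b h ha hb, H.edge_vert h.symm, hkeep b a h.symm hb ha, h⟩

theorem IsComplete.noIsolated_remove (hS : IsComplete R H w S) (hH : NoIsolated H) :
    NoIsolated (remove H (spanned H S)) := by
  rintro x ⟨hx, hxd⟩
  by_contra hn
  have hall : ∀ y, H.Adj x y → ¬ Head S x → Head S y := by
    intro y hxy hxh
    by_contra hy
    exact hn ⟨y, hS.remove_adj_iff.2 ⟨hxy, hxh, hy⟩⟩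
  have hxh : ¬ Head S x := fun h =>
    hxd ⟨hS.mem_verts_iff.2 (.inl h), deg_spanned_of_head h⟩
  obtain ⟨y, hy⟩ := hH x hx
  refine hxd ⟨⟨y, hy, .inr (hall y hy hxh)⟩, deg_congr fun z => ⟨fun h => h.1, fun h => ?_⟩⟩
  exact ⟨h, .inr (hall z h hxh)⟩

theorem IsComplete.ncard_remove_lt [Finite V] (hS : IsComplete R H w S) :
    (remove H (spanned H S)).verts.ncard < H.verts.ncard := by
  refine Set.ncard_lt_ncard ⟨fun x hx => hx.1, fun h => ?_⟩ (Set.toFinite _)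
  have hw : Head S w := ⟨v, hS.base⟩
  exact (h (H.edge_vert (hS.adj _ _ hS.base).symm)).2
    ⟨hS.mem_verts_iff.2 (.inl hw), deg_spanned_of_head hw⟩

/-- The removed tree has `2 * S.card` vertices, hence `4 * S.card - 2` directed edges, and the edges
of `H` are split between it and the rest. -/
theorem IsComplete.numDarts_eq [Finite V] (hS : IsComplete R H w S) :
    numDarts H + 2 = 4 * S.card + numDarts (remove H (spanned H S)) := by
  have h1 := numDarts_add_two R hS.preconnected hS.root_mem
  rw [hS.ncard_verts] at h1
  have h2 : {e : V × V | H.Adj e.1 e.2} = {e | (spanned H S).Adj e.1 e.2} ∪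
      {e | (remove H (spanned H S)).Adj e.1 e.2} := by
    ext ⟨a, b⟩
    simp only [Set.mem_ofPred_eq, Set.mem_union, hS.remove_adj_iff]
    change _ ↔ H.Adj a b ∧ (Head S a ∨ Head S b) ∨ _
    tauto
  have h3 : Disjoint {e : V × V | (spanned H S).Adj e.1 e.2}
      {e | (remove H (spanned H S)).Adj e.1 e.2} := by
    rw [Set.disjoint_left]
    rintro ⟨a, b⟩ ⟨-, h⟩ h'
    have := hS.remove_adj_iff.1 h'
    exact h.elim this.2.1 this.2.2
  have h4 : numDarts H = numDarts (spanned H S) + numDarts (remove H (spanned H S)) := by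
    rw [numDarts, h2, Set.ncard_union_eq h3 (Set.toFinite _) (Set.toFinite _), numDarts, numDarts]
  omega

theorem IsComplete.disjoint_of_mem (hS : IsComplete R H w S) {F : Finset (V × V)}
    (hF : F ∈ forestFamily (remove H (spanned H S))) : Disjoint S F := by
  rw [Finset.disjoint_left]
  rintro ⟨y, x⟩ h h'
  exact (hS.remove_adj_iff.1 (hF.1 _ h')).2.2 ⟨y, h⟩

/-- An edge of `F` outside `S` cannot enter a head, whose incoming edge is in `S`. It cannot leave a
head either: its end would be a head or the chosen leaf there, which gives a second incoming edge or
a pair of opposite edges. -/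
theorem IsComplete.mem_forestFamily_iff [DecidableEq V] (hS : IsComplete R H w S)
    {F : Finset (V × V)} (hSF : S ⊆ F) :
    F \ S ∈ forestFamily (remove H (spanned H S)) ↔ F ∈ forestFamily H := by
  constructor
  · intro hF
    have hcases : ∀ e ∈ F, e ∈ S ∨ e ∈ F \ S := fun e he => by
      by_cases h : e ∈ S
      · exact .inl h
      · exact .inr (Finset.mem_sdiff.2 ⟨he, h⟩)
    have hF1 := fun a b (h : (a, b) ∈ F \ S) => hS.remove_adj_iff.1 (hF.1 _ h)
    refine ⟨fun e he => ?_, fun a b c ha hb => ?_, fun a b ha hb => ?_⟩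
    · rcases hcases e he with h | h
      · exact hS.adj _ _ h
      · exact (hF1 _ _ h).1
    · rcases hcases _ ha with ha | ha <;> rcases hcases _ hb with hb | hb
      · exact hS.inj _ _ _ ha hb
      · exact absurd ⟨a, ha⟩ (hF1 _ _ hb).2.2
      · exact absurd ⟨b, hb⟩ (hF1 _ _ ha).2.2
      · exact hF.2.1 _ _ _ ha hb
    · rcases hcases _ ha with ha | ha <;> rcases hcases _ hb with hb | hb
      · exact hS.not_head_of_mem ha ⟨b, hb⟩
      · exact (hF1 _ _ hb).2.1 ⟨a, ha⟩
      · exact (hF1 _ _ ha).2.1 ⟨b, hb⟩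
      · exact hF.2.2 _ _ ha hb
  · intro hF
    have hlow := isLowerSet_forestFamily H (Finset.sdiff_subset : F \ S ⊆ F) hF
    refine ⟨?_, hlow.2.1, hlow.2.2⟩
    rintro ⟨a, b⟩ h
    obtain ⟨h1, h2⟩ := Finset.mem_sdiff.1 h
    have hb : ¬ Head S b := by
      rintro ⟨z, hz⟩
      exact h2 (hF.2.1 _ _ _ (hSF hz) h1 ▸ hz)
    refine hS.remove_adj_iff.2 ⟨hF.1 _ h1, fun ha => ?_, hb⟩
    rcases hS.head_or_mem (hF.1 _ h1).symm ha with h | h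
    · exact hb h
    · exact hF.2.2 _ _ (hSF h) h1

/-! ### Ordered decompositions -/

variable [LinearOrder V]

theorem IsOrderedDecomposition.verts_ne_empty {L : List T.Subgraph} {B : T.Subgraph}
    (h : IsOrderedDecomposition (B :: L) H) : H.verts ≠ ∅ := by
  obtain ⟨⟨v, hv, -⟩, -⟩ := h
  intro h0
  have := hv.1.1
  rw [h0] at this
  exact this

variable [Fintype V]

/-- The directed edges chosen by a list of basic trees. -/
noncomputable def listDarts : List T.Subgraph → Finset (V × V)
  | [] => ∅
  | B :: L => leafDarts B ∪ listDarts L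

/-- The facets given by the ordered decompositions of `H`. -/
def criticalFaces (H : T.Subgraph) : Set (Finset (V × V)) :=
  {F | ∃ L, IsOrderedDecomposition L H ∧ listDarts L = F}

theorem IsOrderedDecomposition.isComplete {L : List T.Subgraph} {B : T.Subgraph}
    (h : IsOrderedDecomposition (B :: L) H) (R : Rooting T v) (hv : IsFirstLeaf H v)
    (hvw : H.Adj v w) (hleaf : ∀ y, H.Adj v y → y = w) :
    IsComplete R H w (leafDarts B) ∧ spanned H (leafDarts B) = B ∧
      IsOrderedDecomposition L (remove H (spanned H (leafDarts B))) := by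
  obtain ⟨⟨v', hv', hB⟩, hL⟩ := h
  obtain rfl : v' = v := hv'.unique hv
  obtain ⟨h1, h2⟩ := hB.isComplete R hv hvw hleaf
  exact ⟨h1, h2, h2.symm ▸ hL⟩

/-- What makes the facets critical: maximality passes from the remainder to `H`, and each basic tree
contributes one instance of `IsComplete.numDarts_eq` to the count. -/
theorem IsOrderedDecomposition.spec (hT : T.IsTree) {L : List T.Subgraph} {H : T.Subgraph}
    (hH : NoIsolated H) (hL : IsOrderedDecomposition L H) :
    listDarts L ∈ forestFamily H ∧ (∀ F ∈ forestFamily H, listDarts L ⊆ F → F = listDarts L) ∧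
      4 * (listDarts L).card = numDarts H + 2 * L.length := by
  induction L generalizing H with
  | nil =>
    have hno : ∀ a b, ¬ H.Adj a b := fun a b h => by
      have := H.edge_vert h
      rw [show H.verts = ∅ from hL] at this
      exact this
    refine ⟨⟨by simp [listDarts], by simp [listDarts], by simp [listDarts]⟩, fun F hF _ => ?_, ?_⟩
    · exact Finset.eq_empty_of_forall_notMem fun e he => hno _ _ (hF.1 e he)
    · simp [listDarts, numDarts, hno]
  | cons B L ih =>
    obtain ⟨v, hv, -⟩ := hL.1
    obtain ⟨w, hvw, hleaf⟩ := hv.exists_adj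
    obtain ⟨R⟩ := exists_rooting hT v
    obtain ⟨hS, -, hL'⟩ := hL.isComplete R hv hvw hleaf
    obtain ⟨h1, h2, h3⟩ := ih (hS.noIsolated_remove hH) hL'
    have hdisj := hS.disjoint_of_mem h1
    refine ⟨?_, fun F hF hsub => ?_, ?_⟩
    · rw [listDarts, ← hS.mem_forestFamily_iff Finset.subset_union_left]
      rwa [Finset.union_sdiff_cancel_left hdisj]
    · have hSF : leafDarts B ⊆ F := Finset.subset_union_left.trans hsub
      have := h2 _ ((hS.mem_forestFamily_iff hSF).2 hF) fun e he => Finset.mem_sdiff.2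
        ⟨hsub (Finset.mem_union_right _ he), fun he' => Finset.disjoint_left.1 hdisj he' he⟩
      rw [listDarts, ← this, Finset.union_sdiff_of_subset hSF]
    · rw [listDarts, Finset.card_union_of_disjoint hdisj, List.length_cons]
      have := hS.numDarts_eq
      omega

theorem IsOrderedDecomposition.eq_of_listDarts_eq (hT : T.IsTree) {L L' : List T.Subgraph}
    {H : T.Subgraph} (hH : NoIsolated H) (hL : IsOrderedDecomposition L H)
    (hL' : IsOrderedDecomposition L' H) (h : listDarts L = listDarts L') : L = L' := by
  induction L generalizing H L' with
  | nil =>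
    cases L' with
    | nil => rfl
    | cons => exact absurd hL hL'.verts_ne_empty
  | cons B L ih =>
    cases L' with
    | nil => exact absurd hL' hL.verts_ne_empty
    | cons B' L' =>
      obtain ⟨v, hv, -⟩ := hL.1
      obtain ⟨w, hvw, hleaf⟩ := hv.exists_adj
      obtain ⟨R⟩ := exists_rooting hT v
      obtain ⟨hS, e, hM⟩ := hL.isComplete R hv hvw hleaf
      obtain ⟨hS', e', hM'⟩ := hL'.isComplete R hv hvw hleaf
      have hF := (hL.spec hT hH).1
      have hSS : leafDarts B = leafDarts B' := hS.eq_of_subset hS' hF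
        Finset.subset_union_left (h ▸ Finset.subset_union_left)
      rw [← hSS] at hM' e'
      have hH' := hS.noIsolated_remove hH
      have hd := hS.disjoint_of_mem (hM.spec hT hH').1
      have hd' := hS.disjoint_of_mem (hM'.spec hT hH').1
      have hLL : listDarts L = listDarts L' := by
        rw [← Finset.union_sdiff_cancel_left hd, ← Finset.union_sdiff_cancel_left hd']
        congr 1
        rw [listDarts, listDarts, ← hSS] at h
        exact h
      rw [← e, ← e', ih hH' hM hM' hLL]

/-- A vertex of `H` at maximal height can only be adjacent to its parent. -/
theorem exists_isFirstLeaf (hT : T.IsTree) {H : T.Subgraph} (hH : NoIsolated H)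
    (hne : H.verts.Nonempty) : ∃ v, IsFirstLeaf H v := by
  obtain ⟨r, hr⟩ := hne
  obtain ⟨R⟩ := exists_rooting hT r
  obtain ⟨x, hx, hmax⟩ := Set.exists_max_image H.verts R.ht (Set.toFinite _) ⟨r, hr⟩
  have hpar : ∀ y, H.Adj x y → y = R.par x := by
    intro y hy
    rcases R.cases _ _ hy.adj_sub with ⟨-, h⟩ | ⟨hyr, h⟩
    · exact h.symm
    · have h1 := R.ht_par y hyr
      have h2 := hmax y (H.edge_vert hy.symm)
      rw [h] at h1
      omega
  obtain ⟨y, hy⟩ := hH x hx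
  have hleaf : x ∈ {x | x ∈ H.verts ∧ deg H x = 1} :=
    ⟨hx, deg_eq_one_iff.2 ⟨y, hy, fun z hz => (hpar z hz).trans (hpar y hy).symm⟩⟩
  obtain ⟨v, hv, hmin⟩ := Set.exists_min_image {x | x ∈ H.verts ∧ deg H x = 1} id
    (Set.toFinite _) ⟨x, hleaf⟩
  exact ⟨v, hv, hmin⟩

/-- Without the facets given by ordered decompositions, the family of directed forests is
collapsible. -/
theorem collapsible_forestFamily_sdiff (hT : T.IsTree) {H : T.Subgraph} (hH : NoIsolated H) :
    Collapsible (forestFamily H \ criticalFaces H) := by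
  induction hn : H.verts.ncard using Nat.strong_induction_on generalizing H with
  | _ n ih =>
  subst hn
  rcases H.verts.eq_empty_or_nonempty with h0 | hne
  -- The empty edge set is the only forest, and it is critical because of the empty decomposition.
  · have : forestFamily H \ criticalFaces H = ∅ := by
      refine Set.eq_empty_of_forall_notMem fun F hF => hF.2 ⟨[], h0, ?_⟩
      refine (Finset.eq_empty_of_forall_notMem fun e he => ?_).symm
      have := H.edge_vert (hF.1.1 e he)
      rw [h0] at this
      exact this
    rw [this]
    exact .empty
  obtain ⟨v, hv⟩ := exists_isFirstLeaf hT hH hne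
  obtain ⟨w, hvw, hleaf⟩ := hv.exists_adj
  obtain ⟨R⟩ := exists_rooting hT v
  have hcons : ∀ L, IsOrderedDecomposition L H → ∃ B M, L = B :: M := by
    rintro (_ | ⟨B, M⟩) hL
    · exact absurd hL hne.ne_empty
    · exact ⟨B, M, rfl⟩
  refine collapsible_of_isComplete R hvw hleaf ?_ ?_
  · rintro _ ⟨L, hL, rfl⟩
    obtain ⟨B, M, rfl⟩ := hcons L hL
    exact ⟨leafDarts B, (hL.isComplete R hv hvw hleaf).1, Finset.subset_union_left⟩
  · intro S hS
    have := (ih _ hS.ncard_remove_lt (hS.noIsolated_remove hH) rfl).union_left S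
      fun F hF => hS.disjoint_of_mem hF.1
    convert this using 1
    ext F
    simp only [Set.mem_ofPred_eq, Set.mem_sdiff]
    rw [and_comm]
    refine and_congr_right fun hSF => ?_
    rw [hS.mem_forestFamily_iff hSF]
    -- Critical faces of `H` that contain `S` are `S` joined with critical faces of the remainder,
    -- since the first tree must be `spanned H S`.
    refine and_congr_right fun hF => not_congr ⟨?_, ?_⟩
    · rintro ⟨L, hL, rfl⟩
      obtain ⟨B, M, rfl⟩ := hcons L hL
      obtain ⟨hS', -, hM⟩ := hL.isComplete R hv hvw hleaf
      obtain rfl := hS.eq_of_subset hS' hF hSF Finset.subset_union_left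
      refine ⟨M, hM, ?_⟩
      rw [listDarts, Finset.union_sdiff_cancel_left]
      exact hS.disjoint_of_mem (hM.spec hT (hS.noIsolated_remove hH)).1
    · rintro ⟨M, hM, e⟩
      refine ⟨spanned H S :: M, ⟨⟨v, hv, hS.isAdmissible hT.isAcyclic hleaf⟩, hM⟩, ?_⟩
      rw [listDarts, hS.leafDarts_spanned hv, e, Finset.union_sdiff_of_subset hSF]

end Decomposition

/-! ### The complex of directed trees and the dimension count. -/

section Main

variable {V : Type*} {T : SimpleGraph V}

/-- Root the tree at a vertex `x` of a directed cycle and take a vertex of maximal height among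
those lying on closed walks through `x`. Its predecessor and its successor must both be its parent,
so the cycle contains two opposite edges. -/
theorem mem_faces_iff [Finite V] (hT : T.IsTree) {F : Finset (V × V)} :
    F ∈ (directedTreeComplex (doubleDigraph T)).faces ↔
      F.Nonempty ∧ F ∈ forestFamily (⊤ : T.Subgraph) := by
  change F.Nonempty ∧ (∀ e ∈ F, T.Adj e.1 e.2) ∧ IsDirectedForest (F : Set (V × V)) ↔ _
  refine and_congr_right fun hne => ?_
  rw [isDirectedForest_iff]
  constructor
  · rintro ⟨h1, h2, h3⟩
    refine ⟨h1, h3, fun a b hab hba => h2 a ?_⟩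
    exact (Relation.TransGen.single hab).tail hba
  · rintro ⟨h1, h2, h3⟩
    refine ⟨h1, fun x hx => ?_, h2⟩
    obtain ⟨R⟩ := exists_rooting hT x
    let C : Set V := {y | Relation.TransGen (fun a b => (a, b) ∈ (F : Set (V × V))) x y ∧
      Relation.TransGen (fun a b => (a, b) ∈ (F : Set (V × V))) y x}
    obtain ⟨z, ⟨hz, hz'⟩, hmax⟩ := Set.exists_max_image C R.ht (Set.toFinite _) ⟨x, hx, hx⟩
    obtain ⟨a, ha, hza⟩ : ∃ a ∈ C, (z, a) ∈ F := by
      rcases Relation.TransGen.head'_iff.1 hz' with ⟨a, h, h'⟩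
      refine ⟨a, ⟨hz.tail h, ?_⟩, h⟩
      rcases Relation.reflTransGen_iff_eq_or_transGen.1 h' with rfl | h'
      · exact hx
      · exact h'
    obtain ⟨b, hb, hbz⟩ : ∃ b ∈ C, (b, z) ∈ F := by
      rcases Relation.TransGen.tail'_iff.1 hz with ⟨b, h', h⟩
      refine ⟨b, ⟨?_, .head h hz'⟩, h⟩
      rcases Relation.reflTransGen_iff_eq_or_transGen.1 h' with rfl | h'
      · exact hx
      · exact h'
    have key : ∀ y ∈ C, T.Adj z y → R.par z = y := by
      intro y hy h
      rcases R.cases _ _ h with h | ⟨hyx, h⟩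
      · exact h.2
      · have h4 := R.ht_par y hyx
        have h5 := hmax y hy
        rw [h] at h4
        omega
    have hab : a = b := (key a ha (h1 _ hza)).symm.trans (key b hb (h1 _ hbz).symm)
    rw [hab] at hza
    exact h3 _ _ hza hbz

/-- The complex of directed trees of a double directed tree, described by `forestFamily`. -/
def realizationHomeomorph [Fintype V] (hT : T.IsTree) :
    Realization (directedTreeComplex (doubleDigraph T)) ≃ₜ
      geom (forestFamily (⊤ : T.Subgraph)) :=
  Homeomorph.setCongr (X := V × V → ℝ)
    (s := {w | w ∈ stdSimplex ℝ (V × V) ∧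
      ∃ s ∈ (directedTreeComplex (doubleDigraph T)).faces, (s : Set (V × V)) = w.support})
    (t := geom (forestFamily (⊤ : T.Subgraph))) <| by
  ext w
  rw [mem_geom_iff]
  refine and_congr_right fun hw => exists_congr fun s => ?_
  rw [mem_faces_iff hT]
  refine ⟨fun h => ⟨h.1.2, h.2⟩, fun h => ⟨⟨?_, h.1⟩, h.2⟩⟩
  -- The empty set belongs to `forestFamily` but is not a face; it is not the support of any point
  -- of the simplex.
  rw [← Finset.coe_nonempty, h.2, Function.support_nonempty_iff]
  rintro rfl
  have := hw.2
  simp at this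

variable [Fintype V]

theorem noIsolated_top (hT : T.IsTree) (hV : 2 ≤ Fintype.card V) :
    NoIsolated (⊤ : T.Subgraph) := by
  intro x _
  have : Nontrivial V := Fintype.one_lt_card_iff_nontrivial.1 hV
  obtain ⟨y, hy⟩ := hT.connected.preconnected.exists_adj_of_nontrivial x
  exact ⟨y, hy⟩

/-- With `n` vertices, `4 * |F| = 2 * (n - 1) + 2 * m`, so the facet has dimension `d = |F| - 1`
with `n + m = 2 * d + 3`. -/
theorem IsOrderedDecomposition.card_eq [LinearOrder V] (hT : T.IsTree) (hV : 2 ≤ Fintype.card V)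
    {L : List T.Subgraph} (hL : IsOrderedDecomposition L ⊤) :
    ∃ d, Fintype.card V + L.length = 2 * d + 3 ∧ (listDarts L).card = d + 1 := by
  have : Nonempty V := hT.connected.nonempty
  obtain ⟨r⟩ := this
  obtain ⟨R⟩ := exists_rooting hT r
  have hpre : (⊤ : T.Subgraph).coe.Preconnected :=
    (SimpleGraph.Subgraph.topIso (G := T)).symm.connected_iff.1 hT.connected |>.preconnected
  have h1 := numDarts_add_two R hpre (Set.mem_univ r)
  have h2 := (hL.spec hT (noIsolated_top hT hV)).2.2
  rw [SimpleGraph.Subgraph.verts_top, Set.ncard_univ, Nat.card_eq_fintype_card] at h1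
  exact ⟨(listDarts L).card - 1, by omega, by omega⟩

end Main

end DirectedTrees

open DirectedTrees in
theorem mainTheorem1 {V : Type*} [Fintype V] [LinearOrder V] (T : SimpleGraph V)
    (hT : T.IsTree) (hV : 2 ≤ Fintype.card V) :
    (∀ m : ℕ, DirectedTrees.numDecompositions T m ≠ 0 →
      ∃ d : ℕ, Fintype.card V + m = 2 * d + 3) ∧
    Nonempty (ContinuousMap.HomotopyEquiv
      (DirectedTrees.Realization
        (DirectedTrees.directedTreeComplex (DirectedTrees.doubleDigraph T)))
      (DirectedTrees.Wedge
        (fun i : (Σ m : ℕ, Fin (DirectedTrees.numDecompositions T m)) =>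
          DirectedTrees.Sphere.basepoint ((Fintype.card V + i.1 - 3) / 2)))) := by
  classical
  constructor
  · intro m hm
    obtain ⟨L, rfl, hL⟩ := Set.nonempty_of_ncard_ne_zero hm
    obtain ⟨d, hd, -⟩ := hL.card_eq hT hV
    exact ⟨d, hd⟩
  have hno := noIsolated_top hT hV
  let D : ℕ → Set (List T.Subgraph) := fun m =>
    {L | L.length = m ∧ IsOrderedDecomposition L ⊤}
  -- Finiteness matters because `Set.ncard` of an infinite set is 0; here it makes
  -- `numDecompositions` the true count.
  have hfin : ∀ m, Finite (D m) := fun m =>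
    Set.Finite.subset (List.finite_length_eq T.Subgraph m) fun L hL => hL.1
  let e : ∀ m, Fin (numDecompositions T m) ≃ D m := fun m =>
    (Finite.equivFinOfCardEq (Nat.card_coe_set_eq (D m))).symm
  let s : (Σ m : ℕ, Fin (numDecompositions T m)) → Finset (V × V) := fun i =>
    listDarts (e i.1 i.2 : List T.Subgraph)
  have hcard : ∀ i, (s i).card = (Fintype.card V + i.1 - 3) / 2 + 1 := by
    intro i
    obtain ⟨d, hd, hd'⟩ := (e i.1 i.2).2.2.card_eq hT hV
    rw [(e i.1 i.2).2.1] at hd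
    rw [show (s i).card = d + 1 from hd', hd]
    omega
  have hs : Facets (forestFamily (⊤ : T.Subgraph)) s := by
    refine ⟨isLowerSet_forestFamily _, fun i => ((e i.1 i.2).2.2.spec hT hno).1, fun i => ?_, ?_,
      fun i => ((e i.1 i.2).2.2.spec hT hno).2.1⟩
    · rw [← Finset.card_pos, hcard]
      omega
    · rintro ⟨m, i⟩ ⟨m', i'⟩ h
      have hL := (e m i).2.2.eq_of_listDarts_eq hT hno (e m' i').2.2 h
      obtain rfl : m = m' := by rw [← (e m i).2.1, hL, (e m' i').2.1]
      rw [(e m).injective (Subtype.ext hL)]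
  have hrange : Set.range s = criticalFaces (⊤ : T.Subgraph) := by
    ext F
    constructor
    · rintro ⟨i, rfl⟩
      exact ⟨_, (e i.1 i.2).2.2, rfl⟩
    · rintro ⟨L, hL, rfl⟩
      refine ⟨⟨L.length, (e _).symm ⟨L, rfl, hL⟩⟩, ?_⟩
      simp only [s, Equiv.apply_symm_apply]
  -- The index set runs over all `m`, but it embeds into the finite set of edge sets.
  have : Finite (Σ m : ℕ, Fin (numDecompositions T m)) := Finite.of_injective s hs.injective
  have : Fintype (Σ m : ℕ, Fin (numDecompositions T m)) := Fintype.ofFinite _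
  have : ContractibleSpace (geom (forestFamily (⊤ : T.Subgraph) \ Set.range s)) := by
    have hcol := collapsible_forestFamily_sdiff hT hno
    rw [← hrange] at hcol
    refine hcol.contractibleSpace_geom ?_ ⟨∅, ⟨by simp, by simp, by simp⟩, ?_⟩
    · rintro F F' hF ⟨h, h'⟩
      refine ⟨hs.lower hF h, ?_⟩
      rintro ⟨i, rfl⟩
      exact h' ⟨i, (hs.maximal i F h hF).symm⟩
    · rintro ⟨i, hi⟩
      exact (hs.nonempty i).ne_empty hi
  obtain ⟨f⟩ := hs.nonempty_homotopyEquiv_wedge _ hcard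
  exact ⟨(realizationHomeomorph hT).toHomotopyEquiv.trans f⟩
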